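/- Consider the Kolmogorov equation $u_t+xu_y=u_{xx}$. Let $u_{kl}$, $k,l\in\mathbb N_0$, denote the jet variable corresponding to $\partial^{k+l}u/\partial x^k\partial y^l$, $u_{00}:=u$, so that $(t,x,y,u_{kl})$ are coordinates on the manifold defined by the equation and its differential consequences in the infinite-order jet space over $\mathbb R^3_{t,x,y}\times\mathbb R_u$. Differential functions $\eta[u]$ are smooth functions of $(t,x,y)\in\mathbb R^3$ and of finitely many $u_{kl}$. On them, the total derivatives are $$\mathrm D_t=\partial_t+\sum_{k,l\ge0}(u_{k+2,l}-xu_{k,l+1}-ku_{k-1,l+1})\partial_{u_{kl}},\quad \mathrm D_x=\partial_x+\sum_{k,l\ge0}u_{k+1,l}\partial_{u_{kl}},\quad \mathrm D_y=\partial_y+\sum_{k,l\ge0}u_{k,l+1}\partial_{u_{kl}}.$$ Put $\mathrm F:=\mathrm D_t+x\mathrm D_y-\mathrm D_x^2$, let $\Sigma:=\{\eta[u]\partial_u\mid \mathrm F\eta=0\}$ be the algebra of (canonical representatives of) generalized symmetries of the equation, with the Lie bracket $[\eta\partial_u,\theta\partial_u]=\big(\mathrm{pr}(\eta\partial_u)\theta-\mathrm{pr}(\theta\partial_u)\eta\big)\partial_u$,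 $\mathrm{pr}(\eta\partial_u):=\sum_{k,l}(\mathrm D_x^k\mathrm D_y^l\eta)\partial_{u_{kl}}$, and let $$\Lambda:=\Big\{\eta[u]\partial_u\in\Sigma\ \Big|\ \exists\,n\in\mathbb N_0,\ \exists\text{ smooth }\eta^{kl}=\eta^{kl}(t,x,y)\ (k+l\le n):\ \eta[u]=\sum_{k+l\le n}\eta^{kl}u_{kl}\Big\}$$ be the space of linear generalized symmetries. Consider the Lie-symmetry operators $$\mathrm P^3=3t^2\mathrm D_x+t^3\mathrm D_y-3(y-tx),\quad \mathrm P^2=2t\mathrm D_x+t^2\mathrm D_y+x,\quad \mathrm P^1=\mathrm D_x+t\mathrm D_y,\quad \mathrm P^0=\mathrm D_y,$$ the associative operator algebra $\Upsilon_{\mathfrak r}$ (with unit) generated by them, and the real linear span $$\Lambda_{\mathfrak r}:=\big\langle\big((\mathrm P^3)^{i_3}(\mathrm P^2)^{i_2}(\mathrm P^1)^{i_1}(\mathrm P^0)^{i_0}u\big)\partial_u\mid i_0,i_1,i_2,i_3\in\mathbb N_0\big\rangle.$$ Then $\Lambda=\Lambda_{\mathfrak r}$. Moreover, $\Lambda_{\mathfrak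 r}=\{(\mathrm Qu)\partial_u\mid \mathrm Q\in\Upsilon_{\mathfrak r}\}$, i.e. $\Lambda_{\mathfrak r}$ is generated by acting with $\mathrm P^3,\mathrm P^2,\mathrm P^1,\mathrm P^0$ on $u\partial_u$, and $\Lambda=\Lambda_{\mathfrak r}$ is closed under the Lie bracket of $\Sigma$. -/

import Mathlib

open scoped ContDiff

noncomputable section

namespace Kolmogorov

/-- The space `ℝ³` of the independent variables `(t, x, y)`. -/
abbrev Base : Type := ℝ × ℝ × ℝ

/-- The manifold defined by the equation `u_t + x u_y = u_xx` and its differential consequences in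
the infinite-order jet space, in the standard coordinates `(t, x, y, u_kl)`, where `u_kl` stands for
the derivative of order `k` in `x` and `l` in `y`: a point is `((t, x, y), fun (k, l) ↦ u_kl)`. -/
abbrev Jet : Type := Base × (ℕ × ℕ → ℝ)

/-- `η` depends, smoothly, on `t, x, y` and the `u_kl` with `(k, l) ∈ S` only. -/
def SmoothIn (S : Finset (ℕ × ℕ)) (η : Jet → ℝ) : Prop :=
  ∃ g : Base × (S → ℝ) → ℝ, ContDiff ℝ ∞ g ∧ ∀ p : Jet, η p = g (p.1, fun s => p.2 s)

/-- The derivative of `η` with respect to the independent variables in the direction `b`. -/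
def baseDeriv (b : Base) (η : Jet → ℝ) (p : Jet) : ℝ :=
  deriv (fun s : ℝ => η (p.1 + s • b, p.2)) 0

/-- The partial derivative of `η` with respect to `u_kl`, where `i = (k, l)`. -/
def jetDeriv (i : ℕ × ℕ) (η : Jet → ℝ) (p : Jet) : ℝ :=
  deriv (fun s : ℝ => η (p.1, Function.update p.2 i s)) (p.2 i)

theorem SmoothIn.mono {S T : Finset (ℕ × ℕ)} {η : Jet → ℝ} (h : SmoothIn S η) (hST : S ⊆ T) :
    SmoothIn T η := by
  obtain ⟨g, hg, hη⟩ := h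
  refine ⟨fun q => g (q.1, fun s => q.2 ⟨s.1, hST s.2⟩), ?_, fun p => hη p⟩
  exact hg.comp (by fun_prop)

theorem SmoothIn.add {S : Finset (ℕ × ℕ)} {η θ : Jet → ℝ} (h : SmoothIn S η) (h' : SmoothIn S θ) :
    SmoothIn S (η + θ) := by
  obtain ⟨g, hg, hη⟩ := h
  obtain ⟨g', hg', hθ⟩ := h'
  exact ⟨fun q => g q + g' q, hg.add hg', fun p => by simp [hη, hθ]⟩

theorem SmoothIn.mul {S : Finset (ℕ × ℕ)} {η θ : Jet → ℝ} (h : SmoothIn S η) (h' : SmoothIn S θ) :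
    SmoothIn S (η * θ) := by
  obtain ⟨g, hg, hη⟩ := h
  obtain ⟨g', hg', hθ⟩ := h'
  exact ⟨fun q => g q * g' q, hg.mul hg', fun p => by simp [hη, hθ]⟩

theorem smoothIn_base {f : Base → ℝ} (hf : ContDiff ℝ ∞ f) : SmoothIn ∅ (fun p => f p.1) :=
  ⟨fun q => f q.1, hf.comp contDiff_fst, fun _ => rfl⟩

/-- The algebra of differential functions `η[u]`: the smooth functions of `t, x, y` and finitely
many of the jet variables `u_kl`. -/
def DiffFun : Subalgebra ℝ (Jet → ℝ) where
  carrier := {η | ∃ S, SmoothIn S η}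
  mul_mem' := by
    rintro η θ ⟨S, h⟩ ⟨T, h'⟩
    exact ⟨S ∪ T, (h.mono Finset.subset_union_left).mul (h'.mono Finset.subset_union_right)⟩
  add_mem' := by
    rintro η θ ⟨S, h⟩ ⟨T, h'⟩
    exact ⟨S ∪ T, (h.mono Finset.subset_union_left).add (h'.mono Finset.subset_union_right)⟩
  algebraMap_mem' := fun r => ⟨∅, smoothIn_base (f := fun _ => r) contDiff_const⟩

theorem SmoothIn.hasDerivAt_base {S : Finset (ℕ × ℕ)} {η : Jet → ℝ} {g : Base × (S → ℝ) → ℝ}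
    (hg : ContDiff ℝ ∞ g) (hη : ∀ p : Jet, η p = g (p.1, fun s => p.2 s)) (b : Base) (p : Jet) :
    HasDerivAt (fun s : ℝ => η (p.1 + s • b, p.2))
      (fderiv ℝ g (p.1, fun s => p.2 s) (b, 0)) 0 := by
  have h1 : HasDerivAt (fun s : ℝ => ((p.1 + s • b, fun s => p.2 s) : Base × (S → ℝ)))
      (b, 0) 0 := by
    refine HasDerivAt.prodMk ?_ (hasDerivAt_const _ _)
    simpa using ((hasDerivAt_id (0 : ℝ)).smul_const b).const_add p.1
  have h2 : HasFDerivAt g (fderiv ℝ g (p.1, fun s => p.2 s))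
      ((fun s : ℝ => ((p.1 + s • b, fun s => p.2 s) : Base × (S → ℝ))) 0) := by
    simpa using ((hg.differentiable (by simp)) (p.1, fun s => p.2 s)).hasFDerivAt
  have h3 := h2.comp_hasDerivAt (0 : ℝ) h1
  refine h3.congr_of_eventuallyEq (Filter.Eventually.of_forall fun s => ?_)
  simp [hη]

theorem SmoothIn.hasDerivAt_jet {S : Finset (ℕ × ℕ)} {η : Jet → ℝ} {g : Base × (S → ℝ) → ℝ}
    (hg : ContDiff ℝ ∞ g) (hη : ∀ p : Jet, η p = g (p.1, fun s => p.2 s)) (i : ℕ × ℕ) (p : Jet) :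
    HasDerivAt (fun s : ℝ => η (p.1, Function.update p.2 i s))
      (fderiv ℝ g (p.1, fun s => p.2 s) (0, fun s => if s.1 = i then 1 else 0)) (p.2 i) := by
  have h1 : HasDerivAt
      (fun s : ℝ => ((p.1, fun j : S => Function.update p.2 i s j) : Base × (S → ℝ)))
      (0, fun s => if s.1 = i then 1 else 0) (p.2 i) := by
    refine HasDerivAt.prodMk (hasDerivAt_const _ _) (hasDerivAt_pi.2 fun j => ?_)
    by_cases hj : j.1 = i
    · subst hj
      simpa using hasDerivAt_id' (p.2 j.1)
    · simpa [Function.update_of_ne hj, hj] using hasDerivAt_const (p.2 i) (p.2 j.1)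
  have h2 : HasFDerivAt g (fderiv ℝ g (p.1, fun s => p.2 s))
      ((fun s : ℝ => ((p.1, fun j : S => Function.update p.2 i s j) : Base × (S → ℝ))) (p.2 i)) := by
    simpa using ((hg.differentiable (by simp)) (p.1, fun s => p.2 s)).hasFDerivAt
  have h3 := h2.comp_hasDerivAt (p.2 i) h1
  refine h3.congr_of_eventuallyEq (Filter.Eventually.of_forall fun s => ?_)
  simp [hη]

theorem SmoothIn.baseDeriv {S : Finset (ℕ × ℕ)} {η : Jet → ℝ} (h : SmoothIn S η) (b : Base) :
    SmoothIn S (baseDeriv b η) := by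
  obtain ⟨g, hg, hη⟩ := h
  refine ⟨fun q => fderiv ℝ g q (b, 0), ?_, fun p => (hasDerivAt_base hg hη b p).deriv⟩
  exact (hg.fderiv_right (m := ∞) (by simp)).clm_apply contDiff_const

theorem SmoothIn.jetDeriv {S : Finset (ℕ × ℕ)} {η : Jet → ℝ} (h : SmoothIn S η) (i : ℕ × ℕ) :
    SmoothIn S (jetDeriv i η) := by
  obtain ⟨g, hg, hη⟩ := h
  refine ⟨fun q => fderiv ℝ g q (0, fun s => if s.1 = i then 1 else 0), ?_,
    fun p => (hasDerivAt_jet hg hη i p).deriv⟩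
  exact (hg.fderiv_right (m := ∞) (by simp)).clm_apply contDiff_const

theorem SmoothIn.jetDeriv_eq_zero {S : Finset (ℕ × ℕ)} {η : Jet → ℝ} (h : SmoothIn S η)
    {i : ℕ × ℕ} (hi : i ∉ S) : Kolmogorov.jetDeriv i η = 0 := by
  obtain ⟨g, hg, hη⟩ := h
  funext p
  refine (hasDerivAt_jet hg hη i p).deriv.trans ?_
  have : (fun s : S => if s.1 = i then (1 : ℝ) else 0) = 0 := by
    funext s
    have : s.1 ≠ i := fun h => hi (h ▸ s.2)
    simp [this]
  rw [this]
  exact map_zero _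

theorem baseDeriv_mem (b : Base) (η : DiffFun) : baseDeriv b η ∈ DiffFun :=
  let ⟨S, h⟩ := η.2
  ⟨S, h.baseDeriv b⟩

theorem jetDeriv_mem (i : ℕ × ℕ) (η : DiffFun) : jetDeriv i η ∈ DiffFun :=
  let ⟨S, h⟩ := η.2
  ⟨S, h.jetDeriv i⟩

theorem baseDeriv_add (b : Base) (η θ : DiffFun) :
    baseDeriv b (η + θ : DiffFun) = baseDeriv b η + baseDeriv b θ := by
  obtain ⟨S, g, hg, hη⟩ := η.2
  obtain ⟨T, g', hg', hθ⟩ := θ.2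
  funext p
  exact (((SmoothIn.hasDerivAt_base hg hη b p).differentiableAt.hasDerivAt.add
    (SmoothIn.hasDerivAt_base hg' hθ b p).differentiableAt.hasDerivAt).deriv :)

theorem jetDeriv_add (i : ℕ × ℕ) (η θ : DiffFun) :
    jetDeriv i (η + θ : DiffFun) = jetDeriv i η + jetDeriv i θ := by
  obtain ⟨S, g, hg, hη⟩ := η.2
  obtain ⟨T, g', hg', hθ⟩ := θ.2
  funext p
  exact (((SmoothIn.hasDerivAt_jet hg hη i p).differentiableAt.hasDerivAt.add
    (SmoothIn.hasDerivAt_jet hg' hθ i p).differentiableAt.hasDerivAt).deriv :)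

theorem baseDeriv_smul (b : Base) (c : ℝ) (η : DiffFun) :
    baseDeriv b (c • η : DiffFun) = c • baseDeriv b η := by
  obtain ⟨S, g, hg, hη⟩ := η.2
  funext p
  exact (((SmoothIn.hasDerivAt_base hg hη b p).differentiableAt.hasDerivAt.const_smul c).deriv :)

theorem jetDeriv_smul (i : ℕ × ℕ) (c : ℝ) (η : DiffFun) :
    jetDeriv i (c • η : DiffFun) = c • jetDeriv i η := by
  obtain ⟨S, g, hg, hη⟩ := η.2
  funext p
  exact (((SmoothIn.hasDerivAt_jet hg hη i p).differentiableAt.hasDerivAt.const_smul c).deriv :)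

/-- `∂/∂b` on differential functions, `b` a direction in the space of `(t, x, y)`. -/
def pBase (b : Base) : DiffFun →ₗ[ℝ] DiffFun where
  toFun η := ⟨baseDeriv b η, baseDeriv_mem b η⟩
  map_add' η θ := Subtype.ext (baseDeriv_add b η θ)
  map_smul' c η := Subtype.ext (baseDeriv_smul b c η)

/-- `∂/∂u_kl` on differential functions, `i = (k, l)`. -/
def pJet (i : ℕ × ℕ) : DiffFun →ₗ[ℝ] DiffFun where
  toFun η := ⟨jetDeriv i η, jetDeriv_mem i η⟩
  map_add' η θ := Subtype.ext (jetDeriv_add i η θ)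
  map_smul' c η := Subtype.ext (jetDeriv_smul i c η)

theorem finite_pJet (η : DiffFun) : {i | pJet i η ≠ 0}.Finite := by
  obtain ⟨S, h⟩ := η.2
  refine S.finite_toSet.subset fun i hi => ?_
  by_contra hiS
  exact hi (Subtype.ext (h.jetDeriv_eq_zero hiS))

theorem finite_mul_pJet (a : ℕ × ℕ → DiffFun) (η : DiffFun) :
    (Function.support fun i => a i * pJet i η).Finite :=
  (finite_pJet η).subset fun i hi h => hi (by simp [h])

/-- The operator `∂/∂b + ∑_{kl} a_kl ∂/∂u_kl` on differential functions; only finitely many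
terms of the sum do not vanish on a given differential function. -/
def vectorField (b : Base) (a : ℕ × ℕ → DiffFun) : DiffFun →ₗ[ℝ] DiffFun where
  toFun η := pBase b η + ∑ᶠ i, a i * pJet i η
  map_add' η θ := by
    have : ∑ᶠ i, a i * pJet i (η + θ) = ∑ᶠ i, a i * pJet i η + ∑ᶠ i, a i * pJet i θ := by
      rw [← finsum_add_distrib (finite_mul_pJet a η) (finite_mul_pJet a θ)]
      simp [mul_add]
    rw [this, map_add]
    abel
  map_smul' c η := by
    have : ∑ᶠ i, a i * pJet i (c • η) = c • ∑ᶠ i, a i * pJet i η := by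
      rw [smul_finsum' c (finite_mul_pJet a η)]
      simp
    rw [this, map_smul, RingHom.id_apply, smul_add]

/-- The coordinate functions `t`, `x`, `y`. -/
def tVar : DiffFun := ⟨fun p => p.1.1, ∅, smoothIn_base (f := fun q => q.1) (by fun_prop)⟩

/-- See `tVar`. -/
def xVar : DiffFun := ⟨fun p => p.1.2.1, ∅, smoothIn_base (f := fun q => q.2.1) (by fun_prop)⟩

/-- See `tVar`. -/
def yVar : DiffFun := ⟨fun p => p.1.2.2, ∅, smoothIn_base (f := fun q => q.2.2) (by fun_prop)⟩

/-- The jet variable `u_kl`. -/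
def uVar (k l : ℕ) : DiffFun :=
  ⟨fun p => p.2 (k, l), {(k, l)}, fun q => q.2 ⟨(k, l), by simp⟩, by fun_prop, fun _ => rfl⟩

/-- The total derivative in `x`, restricted to the solution manifold of the equation. -/
def Dx : Module.End ℝ DiffFun := vectorField (0, 1, 0) fun i => uVar (i.1 + 1) i.2

/-- The total derivative in `y`, restricted to the solution manifold of the equation. -/
def Dy : Module.End ℝ DiffFun := vectorField (0, 0, 1) fun i => uVar i.1 (i.2 + 1)

/-- The total derivative in `t`, restricted to the solution manifold of the equation:
`∂_t + ∑ (u_{k+2,l} - x u_{k,l+1} - k u_{k-1,l+1}) ∂_{u_kl}`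
(for `k = 0` the last coefficient vanishes). -/
def Dt : Module.End ℝ DiffFun := vectorField (1, 0, 0) fun i =>
  uVar (i.1 + 2) i.2 - xVar * uVar i.1 (i.2 + 1) - (i.1 : DiffFun) * uVar (i.1 - 1) (i.2 + 1)

/-- Multiplication by a differential function, as an operator. -/
def mulOp (f : DiffFun) : Module.End ℝ DiffFun := LinearMap.mulLeft ℝ f

/-- `F = D_t + x D_y - D_x²`. -/
def F : Module.End ℝ DiffFun := Dt + mulOp xVar * Dy - Dx ^ 2

/-- The space `Σ` of (characteristics `η` of) the canonical representatives `η[u] ∂_u` of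
generalized symmetries of the equation `u_t + x u_y = u_xx`. -/
def GenSym : Submodule ℝ DiffFun := LinearMap.ker F

/-- `η` has the form `∑_{k+l ≤ n} η^{kl}(t,x,y) u_kl` for some `n` and some smooth `η^{kl}`. -/
def IsLinear (η : DiffFun) : Prop :=
  ∃ (n : ℕ) (c : ℕ → ℕ → Base → ℝ), (∀ k l, ContDiff ℝ ∞ (c k l)) ∧
    ∀ p : Jet, η.1 p =
      ∑ i ∈ (Finset.range (n + 1) ×ˢ Finset.range (n + 1)).filter (fun i => i.1 + i.2 ≤ n),
        c i.1 i.2 p.1 * p.2 i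

/-- The set `Λ` of (characteristics of) linear generalized symmetries of the equation. -/
def LinGenSym : Set DiffFun := {η | η ∈ GenSym ∧ IsLinear η}

/-- `P³ = 3 t² D_x + t³ D_y - 3 (y - t x)`. -/
def P3 : Module.End ℝ DiffFun :=
  mulOp (3 * tVar ^ 2) * Dx + mulOp (tVar ^ 3) * Dy - mulOp (3 * (yVar - tVar * xVar))

/-- `P² = 2 t D_x + t² D_y + x`. -/
def P2 : Module.End ℝ DiffFun := mulOp (2 * tVar) * Dx + mulOp (tVar ^ 2) * Dy + mulOp xVar

/-- `P¹ = D_x + t D_y`. -/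
def P1 : Module.End ℝ DiffFun := Dx + mulOp tVar * Dy

/-- `P⁰ = D_y`. -/
def P0 : Module.End ℝ DiffFun := Dy

/-- The space `Λ_r` spanned by the `((P³)^i₃ (P²)^i₂ (P¹)^i₁ (P⁰)^i₀ u) ∂_u`. -/
def LambdaR : Submodule ℝ DiffFun :=
  Submodule.span ℝ {η | ∃ i₃ i₂ i₁ i₀ : ℕ, η = (P3 ^ i₃ * P2 ^ i₂ * P1 ^ i₁ * P0 ^ i₀) (uVar 0 0)}

/-- The associative operator algebra generated by `P³`, `P²`, `P¹`, `P⁰`. -/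
def UpsilonR : Subalgebra ℝ (Module.End ℝ DiffFun) := Algebra.adjoin ℝ {P3, P2, P1, P0}

/-- The prolongation `pr(η ∂_u) = ∑ (D_x^k D_y^l η) ∂_{u_kl}`. -/
def pr (η : DiffFun) : Module.End ℝ DiffFun :=
  vectorField 0 fun i => (Dx ^ i.1 * Dy ^ i.2) η

/-- The characteristic of the Lie bracket of the evolutionary vector fields `η ∂_u`, `θ ∂_u`. -/
def bracket (η θ : DiffFun) : DiffFun := pr η θ - pr θ η

end Kolmogorov

end

/-!
A linear differential function is a finite sum `∑ c_kl u_kl` with smooth coefficients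
`c_kl(t, x, y)`, that is, the value at `u` of the operator `∑ c_kl D_x^k D_y^l`. It is a symmetry
exactly when the coefficients satisfy the determining equations (`coeff_F`)

  `(∂_t + x ∂_y - ∂_x²) c_kl = 2 ∂_x c_{k-1,l} + (k + 1) c_{k+1,l-1}`.

The operators `P³`, `P²`, `P¹`, `P⁰` commute with `F` on linear differential functions, so `Λ_r`
consists of symmetries. For the converse, three derivations act on linear differential functions as
"lowering operators" for the operators `P`: `∂_y` with `[∂_y, P³] = -3`, `∂_x` with `[∂_x, P²] = 1`,
and `dXi`, the formal derivative with respect to `D_x`, with `[dXi, P¹] = 1`. They commute with `F`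
only successively: `∂_y` does, `∂_x` does on the kernel of `∂_y`, and `dXi` does on the kernel of
`∂_x`. If a lowering operator is locally nilpotent, every symmetry has a Taylor expansion in powers
of the corresponding `P` with coefficients in its kernel (`mem_span_pow_of_commutator`). Applied
three times, this leaves the symmetries annihilated by all three lowering operators, and for these
the determining equations say that they are combinations of the `u_0l = (P⁰)^l u` with constant
coefficients (`mem_span_P0`).

The analytic core is the local nilpotency of `∂_x` and `∂_y`, that is, that the coefficients of a
symmetry are polynomial in `x` and `y`. Let `n` be the order of the symmetry. Going down the layers
`k + l = n - j`, the determining equations show that the degree in `x` is at most `2 j` and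
that the coefficient of `x^{2j}` in `c_kl` is a nonzero multiple of `∂_y^j c_{k+j,l}`, an entry of
the top layer. In the layer `k + l = -1`, which is zero, this reads `∂_y^{n+1} c = 0` on the whole
top layer; so `∂_y^{n+1}` lowers the order of the symmetry, and induction on the order applies
(`Determining.exists_pow_Y`).

Finally, the prolongation `pr η` of a linear `η` commutes on linear differential functions with all
operators `Q ∈ Υ_r`, so the bracket of `Q u` and `R u` is `R Q u - Q R u`, again a symmetry.
-/

namespace Kolmogorov

/-! ### Taylor expansion with respect to a lowering operator -/

/-- If `A B - B A = c ≠ 0` on an invariant subspace `W`, a vector of `W` on which `A` is nilpotent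
has a Taylor expansion in powers of `B` with coefficients in `W ∩ ker A`. -/
theorem mem_span_pow_of_commutator {V : Type*} [AddCommGroup V] [Module ℝ V] {A B : Module.End ℝ V}
    {W : Submodule ℝ V} {c : ℝ} (hc : c ≠ 0) (hA : ∀ w ∈ W, A w ∈ W) (hB : ∀ w ∈ W, B w ∈ W)
    (hAB : ∀ w ∈ W, A (B w) = B (A w) + c • w) (m : ℕ) {v : V} (hv : v ∈ W)
    (hm : (A ^ m) v = 0) :
    v ∈ Submodule.span ℝ {z | ∃ (i : ℕ) (w : V), w ∈ W ∧ A w = 0 ∧ z = (B ^ i) w} := by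
  induction m generalizing v with
  | zero =>
    rw [show v = 0 by simpa using hm]
    exact Submodule.zero_mem _
  | succ m ih =>
    have hBW : ∀ (i : ℕ) (w : V), w ∈ W → (B ^ i) w ∈ W := fun i w hw => by
      induction i with
      | zero => simpa
      | succ i ih => rw [pow_succ', Module.End.mul_apply]; exact hB _ ih
    have hABi : ∀ (i : ℕ) (w : V), w ∈ W → A w = 0 →
        A ((B ^ (i + 1)) w) = ((i + 1 : ℝ) * c) • (B ^ i) w := fun i w hw h0 => by
      induction i with
      | zero => simp [hAB w hw, h0]
      | succ i ih =>
        rw [pow_succ', Module.End.mul_apply, hAB _ (hBW _ _ hw), ih, map_smul,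
          ← Module.End.mul_apply B, ← pow_succ', ← add_smul]
        push_cast
        congr 1
        ring
    -- `A` maps the span onto itself, so `v` differs from an element of it by a vector of `ker A`
    have hsurj : ∀ z ∈ Submodule.span ℝ {z | ∃ (i : ℕ) (w : V), w ∈ W ∧ A w = 0 ∧ z = (B ^ i) w},
        ∃ z' ∈ Submodule.span ℝ {z | ∃ (i : ℕ) (w : V), w ∈ W ∧ A w = 0 ∧ z = (B ^ i) w},
          z' ∈ W ∧ A z' = z := by
      intro z hz
      induction hz using Submodule.span_induction with
      | mem z hz =>
        obtain ⟨i, w, hw, h0, rfl⟩ := hz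
        refine ⟨((i + 1 : ℝ) * c)⁻¹ • (B ^ (i + 1)) w,
          Submodule.smul_mem _ _ (Submodule.subset_span ⟨i + 1, w, hw, h0, rfl⟩),
          W.smul_mem _ (hBW _ _ hw), ?_⟩
        rw [map_smul, hABi i w hw h0, inv_smul_smul₀ (by positivity)]
      | zero => exact ⟨0, Submodule.zero_mem _, W.zero_mem, map_zero _⟩
      | add a b _ _ ha hb =>
        obtain ⟨a', h1, h2, rfl⟩ := ha
        obtain ⟨b', h3, h4, rfl⟩ := hb
        exact ⟨a' + b', Submodule.add_mem _ h1 h3, W.add_mem h2 h4, map_add _ _ _⟩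
      | smul r a _ ha =>
        obtain ⟨a', h1, h2, rfl⟩ := ha
        exact ⟨r • a', Submodule.smul_mem _ _ h1, W.smul_mem _ h2, map_smul _ _ _⟩
    obtain ⟨z, hz, hzW, hAz⟩ := hsurj (A v) (ih (hA v hv) (by
      rwa [← Module.End.mul_apply, ← pow_succ]))
    rw [← sub_add_cancel v z]
    refine Submodule.add_mem _ (Submodule.subset_span ⟨0, v - z, W.sub_mem hv hzW, ?_, by simp⟩) hz
    rw [map_sub, hAz, sub_self]

/-! ### The determining equations over abstract commuting operators -/

/-- The determining equations, for abstract commuting operators `T`, `X`, `Y` in place of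
`∂_t`, `∂_x`, `∂_y` and `M` in place of the multiplication by `x`. The indices are integers so that
the equations with `k = 0` or `l = 0` need no separate treatment. -/
def Determining {V : Type*} [AddCommGroup V] [Module ℝ V] (T X Y M : Module.End ℝ V)
    (c : ℤ → ℤ → V) : Prop :=
  ∀ k l, T (c k l) + M (Y (c k l)) - X (X (c k l)) =
    (2 : ℝ) • X (c (k - 1) l) + ((k : ℝ) + 1) • c (k + 1) (l - 1)

section Determining

variable {V : Type*} [AddCommGroup V] [Module ℝ V] {T X Y M : Module.End ℝ V} {c : ℤ → ℤ → V}

theorem pow_comm_lowering (hXM : ∀ v, X (M v) = M (X v) + v) (m : ℕ) (v : V) :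
    (X ^ (m + 1)) (M v) = M ((X ^ (m + 1)) v) + ((m : ℝ) + 1) • (X ^ m) v := by
  induction m generalizing v with
  | zero => simp [hXM]
  | succ m ih =>
    rw [pow_succ, Module.End.mul_apply, hXM, map_add, ih, ← Module.End.mul_apply (X ^ (m + 1)) X,
      ← Module.End.mul_apply (X ^ m) X, ← pow_succ, ← pow_succ]
    push_cast
    module

/-- The leading coefficients in `x`: in the layer `k + l = n - j`, the degree in `x` is at most
`2 j`, and the coefficient of `x ^ (2 j)` determines the `j`-th `y`-derivative of an entry of the
top layer. -/
theorem Determining.layer (hc : Determining T X Y M c) (hXT : ∀ v, X (T v) = T (X v))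
    (hXY : ∀ v, X (Y v) = Y (X v)) (hXM : ∀ v, X (M v) = M (X v) + v) {n : ℤ}
    (hn : ∀ k l, n < k + l → c k l = 0) (j : ℕ) :
    (∀ k l, k + l = n - j → (X ^ (2 * j + 1)) (c k l) = 0) ∧
    ∃ r : ℝ, ∀ k l, k + l = n - j → (Y ^ j) (c (k + j) l) = r • (X ^ (2 * j)) (c k l) := by
  have hXT' : ∀ (m : ℕ) v, (X ^ m) (T v) = T ((X ^ m) v) := fun m v =>
    LinearMap.congr_fun ((show Commute X T from LinearMap.ext hXT).pow_left m).eq v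
  have hXY' : ∀ (m : ℕ) v, (X ^ m) (Y v) = Y ((X ^ m) v) := fun m v =>
    LinearMap.congr_fun ((show Commute X Y from LinearMap.ext hXY).pow_left m).eq v
  have hXX : ∀ (m : ℕ) v, (X ^ m) (X v) = (X ^ (m + 1)) v := fun m v => by
    rw [pow_succ, Module.End.mul_apply]
  have hXX' : ∀ (m : ℕ) v, X ((X ^ m) v) = (X ^ (m + 1)) v := fun m v => by
    rw [pow_succ', Module.End.mul_apply]
  induction j with
  | zero =>
    refine ⟨fun k l h => ?_, 1, fun k l h => by simp⟩
    have h1 := hc (k + 1) l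
    rw [hn (k + 1) l (by push_cast at h; omega), hn (k + 1 + 1) (l - 1) (by push_cast at h; omega),
      add_sub_cancel_right] at h1
    simpa using h1.symm
  | succ j ih =>
    obtain ⟨h0, r, hr⟩ := ih
    have key : ∀ k l, k + l = n - (j + 1 : ℕ) →
        (2 : ℝ) • (X ^ (2 * j + 2)) (c k l) =
          (2 * (j : ℝ) + 1) • Y ((X ^ (2 * j)) (c (k + 1) l)) := by
      intro k l h
      -- apply `X ^ (2 j + 1)` to the equation at `(k + 1, l)`: of the terms from the layer of
      -- `c (k + 1) l`, only the commutator of `X ^ (2 j + 1)` with `M` survives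
      have h1 := congrArg (X ^ (2 * j + 1)) (hc (k + 1) l)
      rw [add_sub_cancel_right] at h1
      have e1 := h0 (k + 1) l (by push_cast at h; omega)
      have e2 := h0 (k + 1 + 1) (l - 1) (by push_cast at h; omega)
      simp only [map_add, map_sub, map_smul, hXT', pow_comm_lowering hXM, hXY', hXX, e1, e2] at h1
      rw [← hXX' (2 * j + 1 + 1), ← hXX' (2 * j + 1), e1] at h1
      simpa using h1.symm
    constructor
    · intro k l h
      have h1 := congrArg X (key k l h)
      rw [map_smul, map_smul, hXY, hXX', hXX', h0 (k + 1) l (by push_cast at h; omega)] at h1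
      simpa [mul_add] using h1
    · refine ⟨r * (2 / (2 * j + 1)), fun k l h => ?_⟩
      have h1 := hr (k + 1) l (by push_cast at h; omega)
      rw [pow_succ', Module.End.mul_apply,
        show k + ((j + 1 : ℕ) : ℤ) = k + 1 + j by push_cast; ring, h1, map_smul, mul_smul,
        show 2 * (j + 1) = 2 * j + 2 by ring]
      congr 1
      have h2 : (2 * (j : ℝ) + 1) ≠ 0 := by positivity
      rw [div_eq_inv_mul, mul_smul, key k l h, inv_smul_smul₀ h2]

/-- Solutions of finite support of the determining equations are polynomial in `x`. -/
theorem Determining.exists_pow_X (hc : Determining T X Y M c) (hXT : ∀ v, X (T v) = T (X v))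
    (hXY : ∀ v, X (Y v) = Y (X v)) (hXM : ∀ v, X (M v) = M (X v) + v)
    (h0 : ∀ k l, k < 0 ∨ l < 0 → c k l = 0) {n : ℕ} (hn : ∀ k l, (n : ℤ) < k + l → c k l = 0)
    (k l : ℤ) : (X ^ (2 * n + 1)) (c k l) = 0 := by
  by_cases h : k < 0 ∨ l < 0
  · rw [h0 k l h, map_zero]
  by_cases h' : (n : ℤ) < k + l
  · rw [hn k l h', map_zero]
  have h1 := (hc.layer hXT hXY hXM hn (n - (k + l)).toNat).1 k l (by omega)
  rw [show 2 * n + 1 = 2 * (k + l).toNat + (2 * (n - (k + l)).toNat + 1) by omega, pow_add,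
    Module.End.mul_apply, h1, map_zero]

/-- Solutions of finite support of the determining equations are polynomial in `y`: some power of
`Y`, depending on the order only, takes the top layer to zero and keeps the equations. -/
theorem Determining.exists_pow_Y (hc : Determining T X Y M c) (hXT : ∀ v, X (T v) = T (X v))
    (hXY : ∀ v, X (Y v) = Y (X v)) (hYT : ∀ v, Y (T v) = T (Y v)) (hXM : ∀ v, X (M v) = M (X v) + v)
    (hYM : ∀ v, Y (M v) = M (Y v))
    (h0 : ∀ k l, k < 0 ∨ l < 0 → c k l = 0) {n : ℕ} (hn : ∀ k l, (n : ℤ) ≤ k + l → c k l = 0) :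
    ∃ m : ℕ, ∀ k l, (Y ^ m) (c k l) = 0 := by
  induction n generalizing c with
  | zero => exact ⟨0, fun k l => if h : k < 0 ∨ l < 0 then by simp [h0 k l h] else by
      simp [hn k l (by push_cast; omega)]⟩
  | succ n ih =>
    have hY : ∀ {S : Module.End ℝ V}, (∀ v, Y (S v) = S (Y v)) → ∀ v,
        (Y ^ (n + 1)) (S v) = S ((Y ^ (n + 1)) v) := fun {S} h v =>
      LinearMap.congr_fun ((show Commute Y S from LinearMap.ext h).pow_left (n + 1)).eq v
    have hYX : ∀ v, Y (X v) = X (Y v) := fun v => (hXY v).symm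
    -- beyond the last layer everything vanishes, which kills `Y ^ (n + 1)` of the top layer
    obtain ⟨-, r, hr⟩ := hc.layer hXT hXY hXM (n := n)
      (fun k l h => hn k l (by push_cast; omega)) (n + 1)
    obtain ⟨m, hm⟩ := ih (c := fun k l => (Y ^ (n + 1)) (c k l)) (fun k l => by
        have h := congrArg (Y ^ (n + 1)) (hc k l)
        simpa only [map_add, map_sub, map_smul, hY hYT, hY hYM, hY hYX, hY (S := Y) (fun _ => rfl)]
          using h)
      (fun k l h => by simp only [h0 k l h, map_zero])
      (fun k l h => by
        rcases h.eq_or_lt with h | h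
        · have h1 := hr (k - (n + 1)) l (by push_cast; omega)
          rw [h0 (k - (n + 1)) l (by omega), map_zero, smul_zero] at h1
          simpa using h1
        · simp only [hn k l (by push_cast; omega), map_zero])
    exact ⟨m + (n + 1), fun k l => by rw [pow_add, Module.End.mul_apply]; exact hm k l⟩

end Determining

/-! ### Leibniz rules -/

theorem pBase_mul (b : Base) (η θ : DiffFun) :
    pBase b (η * θ) = pBase b η * θ + η * pBase b θ := by
  obtain ⟨S, g, hg, hη⟩ := η.2
  obtain ⟨T, g', hg', hθ⟩ := θ.2
  refine Subtype.ext (funext fun p => ?_)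
  have h := ((SmoothIn.hasDerivAt_base hg hη b p).differentiableAt.hasDerivAt.mul
    (SmoothIn.hasDerivAt_base hg' hθ b p).differentiableAt.hasDerivAt).deriv
  simp only [zero_smul, add_zero] at h
  exact h

theorem pJet_mul (i : ℕ × ℕ) (η θ : DiffFun) :
    pJet i (η * θ) = pJet i η * θ + η * pJet i θ := by
  obtain ⟨S, g, hg, hη⟩ := η.2
  obtain ⟨T, g', hg', hθ⟩ := θ.2
  refine Subtype.ext (funext fun p => ?_)
  have h := ((SmoothIn.hasDerivAt_jet hg hη i p).differentiableAt.hasDerivAt.mul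
    (SmoothIn.hasDerivAt_jet hg' hθ i p).differentiableAt.hasDerivAt).deriv
  simp only [Function.update_eq_self] at h
  exact h

theorem vectorField_apply (b : Base) (a : ℕ × ℕ → DiffFun) (η : DiffFun) :
    vectorField b a η = pBase b η + ∑ᶠ i, a i * pJet i η := rfl

theorem vectorField_mul (b : Base) (a : ℕ × ℕ → DiffFun) (η θ : DiffFun) :
    vectorField b a (η * θ) = vectorField b a η * θ + η * vectorField b a θ := by
  have h : ∑ᶠ i, a i * pJet i (η * θ) =
      (∑ᶠ i, a i * pJet i η) * θ + η * ∑ᶠ i, a i * pJet i θ := by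
    rw [finsum_mul' _ _ (finite_mul_pJet a η), mul_finsum' _ _ (finite_mul_pJet a θ),
      ← finsum_add_distrib]
    · exact finsum_congr fun i => by rw [pJet_mul]; ring
    · exact (finite_mul_pJet a η).subset fun i hi h => hi (by simp only [h, zero_mul])
    · exact (finite_mul_pJet a θ).subset fun i hi h => hi (by simp only [h, mul_zero])
  simp only [vectorField_apply, pBase_mul, h]
  ring

/-! ### Base functions -/

/-- The differential functions that depend on `t`, `x`, `y` only. -/
def BaseFun : Subalgebra ℝ DiffFun where
  carrier := {f | SmoothIn ∅ f.1}
  mul_mem' h h' := h.mul h'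
  add_mem' h h' := h.add h'
  algebraMap_mem' r := smoothIn_base (f := fun _ => r) contDiff_const

theorem tVar_mem : tVar ∈ BaseFun := smoothIn_base (f := fun q => q.1) (by fun_prop)

theorem xVar_mem : xVar ∈ BaseFun := smoothIn_base (f := fun q => q.2.1) (by fun_prop)

theorem yVar_mem : yVar ∈ BaseFun := smoothIn_base (f := fun q => q.2.2) (by fun_prop)

theorem natCast_mem_baseFun (n : ℕ) : (n : DiffFun) ∈ BaseFun := natCast_mem _ n

theorem pBase_mem {f : DiffFun} (hf : f ∈ BaseFun) (b : Base) : pBase b f ∈ BaseFun :=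
  SmoothIn.baseDeriv hf b

theorem pJet_base {f : DiffFun} (hf : f ∈ BaseFun) (i : ℕ × ℕ) : pJet i f = 0 :=
  Subtype.ext (SmoothIn.jetDeriv_eq_zero hf (by simp))

theorem vectorField_base {f : DiffFun} (hf : f ∈ BaseFun) (b : Base) (a : ℕ × ℕ → DiffFun) :
    vectorField b a f = pBase b f := by
  simp [vectorField_apply, pJet_base hf]

theorem pBase_uVar (b : Base) (k l : ℕ) : pBase b (uVar k l) = 0 := by
  refine Subtype.ext (funext fun p => ?_)
  simp [pBase, baseDeriv, uVar]

theorem pJet_uVar (i j : ℕ × ℕ) : pJet i (uVar j.1 j.2) = if i = j then 1 else 0 := by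
  refine Subtype.ext (funext fun p => ?_)
  by_cases h : i = j
  · subst h
    simp [pJet, jetDeriv, uVar]
  · simp [pJet, jetDeriv, uVar, h, Function.update_of_ne (Ne.symm h)]

theorem vectorField_uVar (b : Base) (a : ℕ × ℕ → DiffFun) (k l : ℕ) :
    vectorField b a (uVar k l) = a (k, l) := by
  have h : ∀ i, a i * pJet i (uVar k l) = if i = (k, l) then a i else 0 := fun i => by
    rw [pJet_uVar i (k, l)]; split_ifs <;> simp
  rw [vectorField_apply, pBase_uVar, finsum_congr h, finsum_eq_single _ (k, l)]
  · simp
  · intro i hi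
    simp [hi]

/-- Symmetry of second derivatives. -/
theorem pBase_comm (b b' : Base) (η : DiffFun) :
    pBase b (pBase b' η) = pBase b' (pBase b η) := by
  obtain ⟨S, g, hg, hη⟩ := η.2
  have h1 : ∀ b : Base, ContDiff ℝ ∞ fun q => fderiv ℝ g q (b, 0) := fun b =>
    (hg.fderiv_right (m := ∞) (by simp)).clm_apply contDiff_const
  have h2 : ∀ (b : Base) (p : Jet), (pBase b η).1 p = fderiv ℝ g (p.1, fun s => p.2 s) (b, 0) :=
    fun b p => (SmoothIn.hasDerivAt_base hg hη b p).deriv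
  have h3 : ∀ (b b' : Base) (p : Jet), (pBase b (pBase b' η)).1 p =
      fderiv ℝ (fderiv ℝ g) (p.1, fun s => p.2 s) (b, 0) (b', 0) := fun b b' p => by
    refine (SmoothIn.hasDerivAt_base (h1 b') (h2 b') b p).deriv.trans ?_
    rw [fderiv_clm_apply ((hg.fderiv_right (m := ∞) (by simp)).differentiable (by simp) _)
      (differentiableAt_const _)]
    simp
  refine Subtype.ext (funext fun p => ?_)
  rw [h3, h3]
  exact (hg.contDiffAt.isSymmSndFDerivAt 
    (by simpa using WithTop.coe_le_coe.2 (le_top : (2 : ℕ∞) ≤ ⊤))) _ _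

theorem pBase_tVar (b : Base) : pBase b tVar = algebraMap ℝ DiffFun b.1 := by
  refine Subtype.ext (funext fun p => ?_)
  simp [pBase, baseDeriv, tVar]

theorem pBase_xVar (b : Base) : pBase b xVar = algebraMap ℝ DiffFun b.2.1 := by
  refine Subtype.ext (funext fun p => ?_)
  simp [pBase, baseDeriv, xVar]

theorem pBase_yVar (b : Base) : pBase b yVar = algebraMap ℝ DiffFun b.2.2 := by
  refine Subtype.ext (funext fun p => ?_)
  simp [pBase, baseDeriv, yVar]

theorem pBase_eq (b : Base) (η : DiffFun) : pBase b η =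
    b.1 • pBase (1, 0, 0) η + b.2.1 • pBase (0, 1, 0) η + b.2.2 • pBase (0, 0, 1) η := by
  obtain ⟨S, g, hg, hη⟩ := η.2
  refine Subtype.ext (funext fun p => ?_)
  have h : ∀ b : Base, (pBase b η).1 p = fderiv ℝ g (p.1, fun s => p.2 s) (b, 0) :=
    fun b => (SmoothIn.hasDerivAt_base hg hη b p).deriv
  change _ = b.1 • (pBase (1, 0, 0) η).1 p + b.2.1 • (pBase (0, 1, 0) η).1 p +
    b.2.2 • (pBase (0, 0, 1) η).1 p
  rw [h, h, h, h, ← map_smul, ← map_smul, ← map_smul, ← map_add, ← map_add]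
  congr 1
  simp

/-- A base function all of whose first derivatives vanish is constant. -/
theorem exists_const {f : DiffFun} (hf : f ∈ BaseFun) (h : ∀ b, pBase b f = 0) :
    ∃ r : ℝ, f = algebraMap ℝ DiffFun r := by
  obtain ⟨g, hg, hη⟩ := hf
  refine ⟨f.1 (0, 0), Subtype.ext (funext fun p => ?_)⟩
  have hd : ∀ q : Base, HasFDerivAt (fun q : Base => f.1 (q, 0)) (0 : Base →L[ℝ] ℝ) q := by
    intro q
    have h0 : HasFDerivAt (fun q : Base => g (q, fun _ => 0))
        ((fderiv ℝ g (q, fun _ => 0)).comp (.inl ℝ Base _)) q :=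
      ((hg.differentiable (by simp)) (q, fun _ => 0)).hasFDerivAt.comp q
        (hasFDerivAt_prodMk_left q _)
    have h1 : (fderiv ℝ g (q, fun _ => 0)).comp (.inl ℝ Base _) = 0 := by
      refine ContinuousLinearMap.ext fun b => ?_
      have := congrFun (congrArg Subtype.val (h b)) (q, 0)
      exact ((SmoothIn.hasDerivAt_base hg hη b (q, 0)).deriv.symm.trans this)
    rw [h1] at h0
    exact h0.congr_of_eventuallyEq (.of_forall fun q => hη (q, 0))
  have := is_const_of_fderiv_eq_zero (fun q => (hd q).differentiableAt)
    (fun q => (hd q).fderiv) p.1 0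
  calc f.1 p = f.1 (p.1, 0) := by
        rw [hη, hη, Subsingleton.elim (fun s : (∅ : Finset (ℕ × ℕ)) => p.2 s)]
    _ = f.1 (0, 0) := this

/-! ### Linear differential functions -/

/-- The differential functions linear in the jet variables `u_kl`, with coefficients depending on
`t`, `x`, `y`. -/
def LinFun : Submodule ℝ DiffFun :=
  Submodule.span ℝ {η | ∃ f ∈ BaseFun, ∃ k l : ℕ, η = f * uVar k l}

theorem mul_uVar_mem {f : DiffFun} (hf : f ∈ BaseFun) (k l : ℕ) : f * uVar k l ∈ LinFun :=
  Submodule.subset_span ⟨f, hf, k, l, rfl⟩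

theorem uVar_mem (k l : ℕ) : uVar k l ∈ LinFun := by
  simpa using mul_uVar_mem (one_mem BaseFun) k l

theorem LinFun.induction {p : DiffFun → Prop} (h : ∀ f ∈ BaseFun, ∀ k l, p (f * uVar k l))
    (h0 : p 0) (hadd : ∀ η θ, p η → p θ → p (η + θ)) (hsmul : ∀ (r : ℝ) η, p η → p (r • η))
    {η : DiffFun} (hη : η ∈ LinFun) : p η := by
  induction hη using Submodule.span_induction with
  | mem η hη => obtain ⟨f, hf, k, l, rfl⟩ := hη; exact h f hf k l
  | zero => exact h0
  | add a b _ _ ha hb => exact hadd a b ha hb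
  | smul r a _ ha => exact hsmul r a ha

/-- Two linear operators agree on linear differential functions if they agree on the products
`f u_kl`. -/
theorem LinFun.ext {A B : Module.End ℝ DiffFun}
    (h : ∀ f ∈ BaseFun, ∀ k l, A (f * uVar k l) = B (f * uVar k l)) {η : DiffFun}
    (hη : η ∈ LinFun) : A η = B η :=
  LinFun.induction (p := fun η => A η = B η) h (by simp) (fun η θ h h' => by simp [h, h'])
    (fun r η h => by simp [h]) hη

theorem LinFun.map_mem {A : Module.End ℝ DiffFun}
    (h : ∀ f ∈ BaseFun, ∀ k l, A (f * uVar k l) ∈ LinFun) {η : DiffFun} (hη : η ∈ LinFun) :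
    A η ∈ LinFun :=
  LinFun.induction (p := fun η => A η ∈ LinFun) h (by simp)
    (fun η θ h h' => by rw [map_add]; exact add_mem h h')
    (fun r η h => by rw [map_smul]; exact LinFun.smul_mem r h) hη

theorem mul_mem_linFun {f η : DiffFun} (hf : f ∈ BaseFun) (hη : η ∈ LinFun) : f * η ∈ LinFun :=
  LinFun.map_mem (A := mulOp f)
    (fun g hg k l => by
      rw [mulOp, LinearMap.mulLeft_apply, ← mul_assoc]; exact mul_uVar_mem (mul_mem hf hg) k l) hη

theorem isLinear_iff {η : DiffFun} : IsLinear η ↔ η ∈ LinFun := by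
  constructor
  · rintro ⟨n, c, hc, h⟩
    let b : ℕ → ℕ → DiffFun := fun k l => ⟨fun p => c k l p.1, ∅, smoothIn_base (hc k l)⟩
    have : η = ∑ i ∈ (Finset.range (n + 1) ×ˢ Finset.range (n + 1)).filter
        (fun i => i.1 + i.2 ≤ n), b i.1 i.2 * uVar i.1 i.2 := by
      refine Subtype.ext (funext fun p => ?_)
      rw [h p, AddSubmonoidClass.coe_finsetSum, Finset.sum_apply]
      rfl
    rw [this]
    exact sum_mem fun i _ => mul_uVar_mem (smoothIn_base (hc i.1 i.2)) _ _
  · -- more terms with vanishing coefficients may be added to match the orders of two summands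
    have hsum : ∀ (m n : ℕ) (c : ℕ → ℕ → Base → ℝ) (p : Jet), n ≤ m →
        ∑ i ∈ (Finset.range (n + 1) ×ˢ Finset.range (n + 1)).filter (fun i => i.1 + i.2 ≤ n),
          c i.1 i.2 p.1 * p.2 i =
        ∑ i ∈ (Finset.range (m + 1) ×ˢ Finset.range (m + 1)).filter (fun i => i.1 + i.2 ≤ m),
          (if i.1 + i.2 ≤ n then c i.1 i.2 else 0) p.1 * p.2 i := by
      intro m n c p hnm
      symm
      rw [← Finset.sum_subset (s₁ := (Finset.range (n + 1) ×ˢ Finset.range (n + 1)).filter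
        (fun i => i.1 + i.2 ≤ n))]
      · exact Finset.sum_congr rfl fun i hi => by simp [(Finset.mem_filter.1 hi).2]
      · intro i
        simp only [Finset.mem_filter, Finset.mem_product, Finset.mem_range]
        omega
      · intro i _ hi
        have : ¬ i.1 + i.2 ≤ n := fun h => hi (by
          simp only [Finset.mem_filter, Finset.mem_product, Finset.mem_range]; omega)
        simp [this]
    -- `LinFun` is spanned by functions of the required form, and these form a subspace
    refine LinFun.induction ?_ ⟨0, fun _ _ => 0, fun _ _ => contDiff_const, fun p => by simp⟩ ?_ ?_
    · rintro f ⟨g, hg, hf⟩ k l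
      refine ⟨k + l, fun a b q => if a = k ∧ b = l then g (q, fun _ => 0) else 0,
        fun a b => ?_, fun p => ?_⟩
      · by_cases h : a = k ∧ b = l
        · simp only [h, and_self, if_true]
          exact hg.comp (by fun_prop)
        · simp only [h, if_false]
          exact contDiff_const
      · rw [Finset.sum_eq_single (k, l)]
        · have : f.1 p = g (p.1, fun _ => 0) := by
            rw [hf, Subsingleton.elim (fun s : (∅ : Finset (ℕ × ℕ)) => p.2 s)]
          simpa [uVar] using Or.inl this
        · intro i _ hi
          have : ¬ (i.1 = k ∧ i.2 = l) := fun h => hi (Prod.ext h.1 h.2)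
          simp [this]
        · intro h
          exfalso
          apply h
          simp only [Finset.mem_filter, Finset.mem_product, Finset.mem_range]
          omega
    · rintro η θ ⟨n, c, hc, h⟩ ⟨m, d, hd, h'⟩
      refine ⟨max n m, fun k l => (if k + l ≤ n then c k l else 0) +
        (if k + l ≤ m then d k l else 0), fun k l => ?_, fun p => ?_⟩
      · refine ContDiff.add ?_ ?_
        · split_ifs
          exacts [hc k l, contDiff_const]
        · split_ifs
          exacts [hd k l, contDiff_const]
      · change η.1 p + θ.1 p = _
        rw [h, h', hsum (max n m) n c p (le_max_left _ _), hsum (max n m) m d p (le_max_right _ _),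
          ← Finset.sum_add_distrib]
        exact Finset.sum_congr rfl fun i _ => (add_mul _ _ _).symm
    · rintro r η ⟨n, c, hc, h⟩
      refine ⟨n, fun k l q => r * c k l q, fun k l => contDiff_const.mul (hc k l), fun p => ?_⟩
      change r * η.1 p = _
      rw [h, Finset.mul_sum]
      exact Finset.sum_congr rfl fun i _ => by ring

/-! ### The operators on products `f u_kl` -/

/-- The derivation `∑ k u_{k-1,l} ∂_{u_kl}`. On a linear differential function `Q u`, with
`Q = ∑ c_kl D_x^k D_y^l`, it is the formal derivative of `Q` with respect to `D_x`. -/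
noncomputable def dXi : Module.End ℝ DiffFun :=
  vectorField 0 fun i => (i.1 : DiffFun) * uVar (i.1 - 1) i.2

theorem pBase_zero (f : DiffFun) : pBase 0 f = 0 := by
  refine Subtype.ext (funext fun p => ?_)
  simp [pBase, baseDeriv]

theorem vectorField_mul_uVar {f : DiffFun} (hf : f ∈ BaseFun) (b : Base) (a : ℕ × ℕ → DiffFun)
    (k l : ℕ) : vectorField b a (f * uVar k l) = pBase b f * uVar k l + f * a (k, l) := by
  rw [vectorField_mul, vectorField_base hf, vectorField_uVar]

theorem pBase_mul_uVar (f : DiffFun) (b : Base) (k l : ℕ) :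
    pBase b (f * uVar k l) = pBase b f * uVar k l := by
  rw [pBase_mul, pBase_uVar, mul_zero, add_zero]

theorem Dx_mul_uVar {f : DiffFun} (hf : f ∈ BaseFun) (k l : ℕ) :
    Dx (f * uVar k l) = pBase (0, 1, 0) f * uVar k l + f * uVar (k + 1) l :=
  vectorField_mul_uVar hf _ _ k l

theorem Dy_mul_uVar {f : DiffFun} (hf : f ∈ BaseFun) (k l : ℕ) :
    Dy (f * uVar k l) = pBase (0, 0, 1) f * uVar k l + f * uVar k (l + 1) :=
  vectorField_mul_uVar hf _ _ k l

theorem Dt_mul_uVar {f : DiffFun} (hf : f ∈ BaseFun) (k l : ℕ) :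
    Dt (f * uVar k l) = pBase (1, 0, 0) f * uVar k l +
      f * (uVar (k + 2) l - xVar * uVar k (l + 1) - (k : DiffFun) * uVar (k - 1) (l + 1)) :=
  vectorField_mul_uVar hf _ _ k l

theorem dXi_mul_uVar {f : DiffFun} (hf : f ∈ BaseFun) (k l : ℕ) :
    dXi (f * uVar k l) = f * (k : DiffFun) * uVar (k - 1) l := by
  rw [dXi, vectorField_mul_uVar hf, pBase_zero]
  ring

theorem F_apply (η : DiffFun) : F η = Dt η + xVar * Dy η - Dx (Dx η) := by
  rw [F, sq]
  rfl

/-- The operator `F` in coordinates. The equation enters here: it reduces `F u_kl` to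
`- k u_{k-1,l+1}`. -/
theorem F_mul_uVar {f : DiffFun} (hf : f ∈ BaseFun) (k l : ℕ) :
    F (f * uVar k l) = (pBase (1, 0, 0) f + xVar * pBase (0, 0, 1) f -
        pBase (0, 1, 0) (pBase (0, 1, 0) f)) * uVar k l -
      2 * pBase (0, 1, 0) f * uVar (k + 1) l - f * (k : DiffFun) * uVar (k - 1) (l + 1) := by
  rw [F_apply, Dt_mul_uVar hf, Dy_mul_uVar hf, Dx_mul_uVar hf, map_add,
    Dx_mul_uVar (pBase_mem hf _), Dx_mul_uVar hf]
  ring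

theorem pBase_lin {w : DiffFun} (hw : w ∈ LinFun) (b : Base) : pBase b w ∈ LinFun :=
  LinFun.map_mem (fun f hf k l => by
    rw [pBase_mul_uVar]; exact mul_uVar_mem (pBase_mem hf b) _ _) hw

theorem Dx_lin {w : DiffFun} (hw : w ∈ LinFun) : Dx w ∈ LinFun :=
  LinFun.map_mem (fun f hf k l => by
    rw [Dx_mul_uVar hf]
    exact add_mem (mul_uVar_mem (pBase_mem hf _) _ _) (mul_uVar_mem hf _ _)) hw

theorem Dy_lin {w : DiffFun} (hw : w ∈ LinFun) : Dy w ∈ LinFun :=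
  LinFun.map_mem (fun f hf k l => by
    rw [Dy_mul_uVar hf]
    exact add_mem (mul_uVar_mem (pBase_mem hf _) _ _) (mul_uVar_mem hf _ _)) hw

theorem dXi_lin {w : DiffFun} (hw : w ∈ LinFun) : dXi w ∈ LinFun :=
  LinFun.map_mem (fun f hf k l => by
    rw [dXi_mul_uVar hf]
    exact mul_uVar_mem (mul_mem hf (natCast_mem_baseFun k)) _ _) hw

/-! ### Commutation relations -/

theorem Dx_mul (η θ : DiffFun) : Dx (η * θ) = Dx η * θ + η * Dx θ := vectorField_mul _ _ η θ

theorem Dy_mul (η θ : DiffFun) : Dy (η * θ) = Dy η * θ + η * Dy θ := vectorField_mul _ _ η θ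

theorem Dt_mul (η θ : DiffFun) : Dt (η * θ) = Dt η * θ + η * Dt θ := vectorField_mul _ _ η θ

theorem pBase_Dx (b : Base) {w : DiffFun} (hw : w ∈ LinFun) : pBase b (Dx w) = Dx (pBase b w) :=
  LinFun.ext (A := pBase b * Dx) (B := Dx * pBase b) (fun f hf k l => by
    simp only [Module.End.mul_apply, pBase_mul_uVar, Dx_mul_uVar hf, map_add,
      Dx_mul_uVar (pBase_mem hf _), pBase_comm b]) hw

theorem pBase_Dy (b : Base) {w : DiffFun} (hw : w ∈ LinFun) : pBase b (Dy w) = Dy (pBase b w) :=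
  LinFun.ext (A := pBase b * Dy) (B := Dy * pBase b) (fun f hf k l => by
    simp only [Module.End.mul_apply, pBase_mul_uVar, Dy_mul_uVar hf, map_add,
      Dy_mul_uVar (pBase_mem hf _), pBase_comm b]) hw

theorem Dy_Dx {w : DiffFun} (hw : w ∈ LinFun) : Dy (Dx w) = Dx (Dy w) :=
  LinFun.ext (A := Dy * Dx) (B := Dx * Dy) (fun f hf k l => by
    simp only [Module.End.mul_apply, Dy_mul_uVar hf, Dx_mul_uVar hf, map_add,
      Dx_mul_uVar (pBase_mem hf _), Dy_mul_uVar (pBase_mem hf _), pBase_comm (0, 0, 1) (0, 1, 0)]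
    ring) hw

theorem Dt_base {f : DiffFun} (hf : f ∈ BaseFun) : Dt f = pBase (1, 0, 0) f :=
  vectorField_base hf _ _

theorem Dx_base {f : DiffFun} (hf : f ∈ BaseFun) : Dx f = pBase (0, 1, 0) f :=
  vectorField_base hf _ _

theorem Dy_base {f : DiffFun} (hf : f ∈ BaseFun) : Dy f = pBase (0, 0, 1) f :=
  vectorField_base hf _ _

theorem Dt_uVar (k l : ℕ) : Dt (uVar k l) =
    uVar (k + 2) l - xVar * uVar k (l + 1) - (k : DiffFun) * uVar (k - 1) (l + 1) :=
  vectorField_uVar _ _ k l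

theorem Dx_uVar (k l : ℕ) : Dx (uVar k l) = uVar (k + 1) l := vectorField_uVar _ _ k l

theorem Dy_uVar (k l : ℕ) : Dy (uVar k l) = uVar k (l + 1) := vectorField_uVar _ _ k l

theorem pBase_natCast (b : Base) (n : ℕ) : pBase b (n : DiffFun) = 0 := by
  refine Subtype.ext (funext fun p => ?_)
  simp [pBase, baseDeriv]

theorem Dt_natCast (n : ℕ) : Dt (n : DiffFun) = 0 := by
  rw [Dt_base (natCast_mem_baseFun n), pBase_natCast]

theorem Dx_natCast (n : ℕ) : Dx (n : DiffFun) = 0 := by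
  rw [Dx_base (natCast_mem_baseFun n), pBase_natCast]

@[simp] theorem Dx_one : Dx 1 = 0 := by simpa using Dx_natCast 1

@[simp] theorem Dx_two : Dx 2 = 0 := Dx_natCast 2

@[simp] theorem Dx_three : Dx 3 = 0 := Dx_natCast 3

theorem Dy_natCast (n : ℕ) : Dy (n : DiffFun) = 0 := by
  rw [Dy_base (natCast_mem_baseFun n), pBase_natCast]

@[simp] theorem Dt_tVar : Dt tVar = 1 := by rw [Dt_base tVar_mem, pBase_tVar]; simp
@[simp] theorem Dt_xVar : Dt xVar = 0 := by rw [Dt_base xVar_mem, pBase_xVar]; simp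
@[simp] theorem Dt_yVar : Dt yVar = 0 := by rw [Dt_base yVar_mem, pBase_yVar]; simp
@[simp] theorem Dx_tVar : Dx tVar = 0 := by rw [Dx_base tVar_mem, pBase_tVar]; simp
@[simp] theorem Dx_xVar : Dx xVar = 1 := by rw [Dx_base xVar_mem, pBase_xVar]; simp
@[simp] theorem Dx_yVar : Dx yVar = 0 := by rw [Dx_base yVar_mem, pBase_yVar]; simp
@[simp] theorem Dy_tVar : Dy tVar = 0 := by rw [Dy_base tVar_mem, pBase_tVar]; simp
@[simp] theorem Dy_xVar : Dy xVar = 0 := by rw [Dy_base xVar_mem, pBase_xVar]; simp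
@[simp] theorem Dy_yVar : Dy yVar = 1 := by rw [Dy_base yVar_mem, pBase_yVar]; simp

theorem Dt_Dy {w : DiffFun} (hw : w ∈ LinFun) : Dt (Dy w) = Dy (Dt w) :=
  LinFun.ext (A := Dt * Dy) (B := Dy * Dt) (fun f hf k l => by
    simp only [Module.End.mul_apply, Dy_mul, Dt_mul, Dt_uVar, Dy_uVar, Dy_base hf, Dt_base hf,
      map_add, map_sub, Dt_base (pBase_mem hf _), Dy_base (pBase_mem hf _), Dy_xVar, Dy_natCast,
      pBase_comm (1, 0, 0) (0, 0, 1)]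
    ring) hw

theorem Dt_Dx {w : DiffFun} (hw : w ∈ LinFun) : Dt (Dx w) = Dx (Dt w) :=
  LinFun.ext (A := Dt * Dx) (B := Dx * Dt) (fun f hf k l => by
    cases k <;>
    simp only [Module.End.mul_apply, Dx_mul, Dt_mul, Dt_uVar, Dx_uVar, Dx_base hf, Dt_base hf,
      map_add, map_sub, Dt_base (pBase_mem hf _), Dx_base (pBase_mem hf _), Dx_xVar, Dx_natCast,
      pBase_comm (1, 0, 0) (0, 1, 0), Nat.add_sub_cancel, Nat.cast_add, Nat.cast_one,
      Nat.cast_zero, map_zero, Dx_one] <;>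
    ring) hw

/-- `F` is of second order, with second-order part `- D_x²`. -/
theorem F_mul (η θ : DiffFun) : F (η * θ) = F η * θ + η * F θ - 2 * Dx η * Dx θ := by
  simp only [F_apply, Dt_mul, Dx_mul, Dy_mul, map_add]
  ring

theorem F_Dy {w : DiffFun} (hw : w ∈ LinFun) : F (Dy w) = Dy (F w) := by
  simp only [F_apply, map_add, map_sub, Dt_Dy hw, Dy_mul, Dy_xVar, Dy_Dx hw, Dy_Dx (Dx_lin hw)]
  ring

theorem F_Dx {w : DiffFun} (hw : w ∈ LinFun) : F (Dx w) = Dx (F w) - Dy w := by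
  simp only [F_apply, map_add, map_sub, Dt_Dx hw, Dx_mul, Dx_xVar, Dy_Dx hw]
  ring

theorem F_tVar : F tVar = 1 := by simp [F_apply]

theorem F_xVar : F xVar = 0 := by simp [F_apply]

theorem F_yVar : F yVar = xVar := by simp [F_apply]

/-! ### The operators `P⁰`, `P¹`, `P²`, `P³` are symmetries -/

theorem P0_apply (w : DiffFun) : P0 w = Dy w := rfl

theorem P1_apply (w : DiffFun) : P1 w = Dx w + tVar * Dy w := rfl

theorem P2_apply (w : DiffFun) : P2 w = 2 * tVar * Dx w + tVar ^ 2 * Dy w + xVar * w := rfl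

theorem P3_apply (w : DiffFun) :
    P3 w = 3 * tVar ^ 2 * Dx w + tVar ^ 3 * Dy w - 3 * (yVar - tVar * xVar) * w := rfl

theorem two_mem_baseFun : (2 : DiffFun) ∈ BaseFun := natCast_mem_baseFun 2

theorem three_mem_baseFun : (3 : DiffFun) ∈ BaseFun := natCast_mem_baseFun 3

theorem P0_lin {w : DiffFun} (hw : w ∈ LinFun) : P0 w ∈ LinFun := Dy_lin hw

theorem P1_lin {w : DiffFun} (hw : w ∈ LinFun) : P1 w ∈ LinFun :=
  add_mem (Dx_lin hw) (mul_mem_linFun tVar_mem (Dy_lin hw))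

theorem P2_lin {w : DiffFun} (hw : w ∈ LinFun) : P2 w ∈ LinFun :=
  add_mem (add_mem (mul_mem_linFun (mul_mem two_mem_baseFun tVar_mem) (Dx_lin hw))
    (mul_mem_linFun (pow_mem tVar_mem 2) (Dy_lin hw))) (mul_mem_linFun xVar_mem hw)

theorem P3_lin {w : DiffFun} (hw : w ∈ LinFun) : P3 w ∈ LinFun :=
  sub_mem (add_mem
    (mul_mem_linFun (mul_mem three_mem_baseFun (pow_mem tVar_mem 2)) (Dx_lin hw))
    (mul_mem_linFun (pow_mem tVar_mem 3) (Dy_lin hw)))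
    (mul_mem_linFun (mul_mem three_mem_baseFun
      (sub_mem yVar_mem (mul_mem tVar_mem xVar_mem))) hw)

theorem F_natCast (n : ℕ) : F (n : DiffFun) = 0 := by
  simp [F_apply, Dt_natCast, Dx_natCast, Dy_natCast]

theorem F_two : F 2 = 0 := F_natCast 2

theorem F_three : F 3 = 0 := F_natCast 3

theorem F_P0 {w : DiffFun} (hw : w ∈ LinFun) : F (P0 w) = P0 (F w) := F_Dy hw

theorem F_P1 {w : DiffFun} (hw : w ∈ LinFun) : F (P1 w) = P1 (F w) := by
  simp only [P1_apply, map_add, F_mul, F_Dx hw, F_Dy hw, F_tVar, Dx_tVar]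
  ring

theorem F_P2 {w : DiffFun} (hw : w ∈ LinFun) : F (P2 w) = P2 (F w) := by
  simp only [P2_apply, map_add, mul_assoc, sq, F_mul, F_two, Dx_two, F_Dx hw, F_Dy hw,
    F_tVar, F_xVar, Dx_tVar, Dx_xVar, Dx_mul]
  ring

theorem F_P3 {w : DiffFun} (hw : w ∈ LinFun) : F (P3 w) = P3 (F w) := by
  simp only [P3_apply, map_add, map_sub, mul_assoc, sub_mul, F_three, Dx_three, pow_succ, pow_zero,
    one_mul, F_mul, F_Dx hw, F_Dy hw, F_tVar, F_xVar, F_yVar, Dx_tVar, Dx_xVar, Dx_yVar, Dx_mul]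
  ring

/-- The linear generalized symmetries, as a subspace. -/
noncomputable def LinSym : Submodule ℝ DiffFun := LinFun ⊓ LinearMap.ker F

theorem mem_linSym {η : DiffFun} : η ∈ LinSym ↔ η ∈ LinFun ∧ F η = 0 := Iff.rfl

theorem linGenSym_eq : LinGenSym = (LinSym : Set DiffFun) := by
  ext η
  exact ⟨fun h => ⟨isLinear_iff.1 h.2, h.1⟩, fun h => ⟨h.2, isLinear_iff.2 h.1⟩⟩

theorem uVar_mem_linSym : uVar 0 0 ∈ LinSym :=
  ⟨uVar_mem 0 0, by
    have h := F_mul_uVar (one_mem BaseFun) 0 0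
    have h1 : ∀ b, pBase b (1 : DiffFun) = 0 := fun b => by simpa using pBase_natCast b 1
    simpa [h1] using h⟩

theorem UpsilonR.mem_linSym {Q : Module.End ℝ DiffFun} (hQ : Q ∈ UpsilonR) :
    ∀ w ∈ LinSym, Q w ∈ LinSym := by
  have aux : ∀ {P : Module.End ℝ DiffFun}, (∀ {w}, w ∈ LinFun → P w ∈ LinFun) →
      (∀ {w}, w ∈ LinFun → F (P w) = P (F w)) → ∀ w ∈ LinSym, P w ∈ LinSym :=
    fun h h' w hw => ⟨h hw.1, LinearMap.mem_ker.2 (by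
      rw [h' hw.1, LinearMap.mem_ker.1 hw.2, map_zero])⟩
  induction hQ using Algebra.adjoin_induction with
  | mem Q hQ =>
    rcases hQ with rfl | rfl | rfl | rfl
    exacts [aux P3_lin F_P3, aux P2_lin F_P2, aux P1_lin F_P1, aux P0_lin F_P0]
  | algebraMap r => exact fun w hw => LinSym.smul_mem r hw
  | add Q R _ _ hQ hR => exact fun w hw => add_mem (hQ w hw) (hR w hw)
  | mul Q R _ _ hQ hR => exact fun w hw => hQ _ (hR w hw)

theorem P0_mem_upsilonR : P0 ∈ UpsilonR := Algebra.subset_adjoin (by simp)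

theorem P1_mem_upsilonR : P1 ∈ UpsilonR := Algebra.subset_adjoin (by simp)

theorem P2_mem_upsilonR : P2 ∈ UpsilonR := Algebra.subset_adjoin (by simp)

theorem P3_mem_upsilonR : P3 ∈ UpsilonR := Algebra.subset_adjoin (by simp)

theorem exists_upsilonR_of_mem_lambdaR {η : DiffFun} (hη : η ∈ LambdaR) :
    ∃ Q ∈ UpsilonR, Q (uVar 0 0) = η := by
  induction hη using Submodule.span_induction with
  | mem η hη =>
    obtain ⟨a, b, c, d, rfl⟩ := hη
    exact ⟨_, mul_mem (mul_mem (mul_mem (pow_mem P3_mem_upsilonR a) (pow_mem P2_mem_upsilonR b))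
      (pow_mem P1_mem_upsilonR c)) (pow_mem P0_mem_upsilonR d), rfl⟩
  | zero => exact ⟨0, zero_mem _, rfl⟩
  | add _ _ _ _ h h' =>
    obtain ⟨Q, hQ, rfl⟩ := h
    obtain ⟨R, hR, rfl⟩ := h'
    exact ⟨Q + R, add_mem hQ hR, rfl⟩
  | smul r _ _ h =>
    obtain ⟨Q, hQ, rfl⟩ := h
    exact ⟨r • Q, Subalgebra.smul_mem _ hQ r, rfl⟩

theorem lambdaR_le_linSym : LambdaR ≤ LinSym := fun η hη => by
  obtain ⟨Q, hQ, rfl⟩ := exists_upsilonR_of_mem_lambdaR hη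
  exact UpsilonR.mem_linSym hQ _ uVar_mem_linSym

/-! ### The Lie bracket -/

theorem pr_mul (η θ w : DiffFun) : pr η (θ * w) = pr η θ * w + θ * pr η w :=
  vectorField_mul _ _ θ w

theorem pr_base (η : DiffFun) {f : DiffFun} (hf : f ∈ BaseFun) : pr η f = 0 := by
  rw [pr, vectorField_base hf, pBase_zero]

theorem pr_base_mul (η : DiffFun) {f : DiffFun} (hf : f ∈ BaseFun) (w : DiffFun) :
    pr η (f * w) = f * pr η w := by
  rw [pr_mul, pr_base η hf, zero_mul, zero_add]

theorem pr_uVar (η : DiffFun) (k l : ℕ) : pr η (uVar k l) = (Dx ^ k) ((Dy ^ l) η) :=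
  vectorField_uVar _ _ k l

theorem Dy_pow_lin {w : DiffFun} (hw : w ∈ LinFun) (l : ℕ) : (Dy ^ l) w ∈ LinFun := by
  induction l with
  | zero => simpa
  | succ l ih => rw [pow_succ', Module.End.mul_apply]; exact Dy_lin ih

theorem Dx_pow_lin {w : DiffFun} (hw : w ∈ LinFun) (l : ℕ) : (Dx ^ l) w ∈ LinFun := by
  induction l with
  | zero => simpa
  | succ l ih => rw [pow_succ', Module.End.mul_apply]; exact Dx_lin ih

theorem Dy_Dx_pow {w : DiffFun} (hw : w ∈ LinFun) (k : ℕ) :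
    Dy ((Dx ^ k) w) = (Dx ^ k) (Dy w) := by
  induction k with
  | zero => simp
  | succ k ih => simp only [pow_succ', Module.End.mul_apply, Dy_Dx (Dx_pow_lin hw k), ih]

theorem pr_Dx (η : DiffFun) {w : DiffFun} (hw : w ∈ LinFun) : pr η (Dx w) = Dx (pr η w) :=
  LinFun.ext (A := pr η * Dx) (B := Dx * pr η) (fun f hf k l => by
    simp only [Module.End.mul_apply, Dx_mul_uVar hf, map_add, pr_base_mul η (pBase_mem hf _),
      pr_base_mul η hf, pr_uVar, Dx_mul, Dx_base hf, pow_succ']) hw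

theorem pr_Dy {η : DiffFun} (hη : η ∈ LinFun) {w : DiffFun} (hw : w ∈ LinFun) :
    pr η (Dy w) = Dy (pr η w) :=
  LinFun.ext (A := pr η * Dy) (B := Dy * pr η) (fun f hf k l => by
    simp only [Module.End.mul_apply, Dy_mul_uVar hf, map_add, pr_base_mul η (pBase_mem hf _),
      pr_base_mul η hf, pr_uVar, Dy_mul, Dy_base hf, pow_succ', Dy_Dx_pow (Dy_pow_lin hη l)]) hw

/-- The prolongation of a linear `η` commutes with the operators in `Υ_r` on linear differential
functions. -/
theorem UpsilonR.lin_and_pr {η : DiffFun} (hη : η ∈ LinFun) {Q : Module.End ℝ DiffFun}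
    (hQ : Q ∈ UpsilonR) : ∀ w ∈ LinFun, Q w ∈ LinFun ∧ pr η (Q w) = Q (pr η w) := by
  induction hQ using Algebra.adjoin_induction with
  | mem Q hQ =>
    intro w hw
    rcases hQ with rfl | rfl | rfl | rfl
    · refine ⟨P3_lin hw, ?_⟩
      rw [P3_apply, map_sub, map_add,
        pr_base_mul η (mul_mem three_mem_baseFun (pow_mem tVar_mem 2)),
        pr_base_mul η (pow_mem tVar_mem 3), pr_base_mul η (mul_mem three_mem_baseFun
        (sub_mem yVar_mem (mul_mem tVar_mem xVar_mem))), pr_Dx η hw, pr_Dy hη hw, P3_apply]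
    · refine ⟨P2_lin hw, ?_⟩
      rw [P2_apply, map_add, map_add, pr_base_mul η (mul_mem two_mem_baseFun tVar_mem),
        pr_base_mul η (pow_mem tVar_mem 2), pr_base_mul η xVar_mem, pr_Dx η hw, pr_Dy hη hw,
        P2_apply]
    · refine ⟨P1_lin hw, ?_⟩
      rw [P1_apply, map_add, pr_base_mul η tVar_mem, pr_Dx η hw, pr_Dy hη hw, P1_apply]
    · exact ⟨P0_lin hw, pr_Dy hη hw⟩
  | algebraMap r => exact fun w hw => ⟨LinFun.smul_mem r hw, (pr η).map_smul r w⟩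
  | add Q R _ _ hQ hR => exact fun w hw => ⟨add_mem (hQ w hw).1 (hR w hw).1, by
      rw [LinearMap.add_apply, map_add, (hQ w hw).2, (hR w hw).2, LinearMap.add_apply]⟩
  | mul Q R _ _ hQ hR => exact fun w hw => ⟨(hQ _ (hR w hw).1).1, by
      rw [Module.End.mul_apply, (hQ _ (hR w hw).1).2, (hR w hw).2, Module.End.mul_apply]⟩

theorem bracket_eq {Q R : Module.End ℝ DiffFun} (hQ : Q ∈ UpsilonR) (hR : R ∈ UpsilonR)
    (hη : Q (uVar 0 0) ∈ LinFun) (hθ : R (uVar 0 0) ∈ LinFun) :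
    bracket (Q (uVar 0 0)) (R (uVar 0 0)) = R (Q (uVar 0 0)) - Q (R (uVar 0 0)) := by
  rw [bracket, (UpsilonR.lin_and_pr hη hR _ (uVar_mem 0 0)).2,
    (UpsilonR.lin_and_pr hθ hQ _ (uVar_mem 0 0)).2, pr_uVar, pr_uVar]
  simp

/-! ### Coefficients of linear differential functions -/

/-- The coefficient of `u_kl`, with the convention that it vanishes for negative `k` or `l`. -/
noncomputable def coeff (k l : ℤ) : Module.End ℝ DiffFun :=
  if 0 ≤ k ∧ 0 ≤ l then pJet (k.toNat, l.toNat) else 0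

theorem pJet_mul_uVar {f : DiffFun} (hf : f ∈ BaseFun) (i : ℕ × ℕ) (k l : ℕ) :
    pJet i (f * uVar k l) = if i = (k, l) then f else 0 := by
  rw [pJet_mul, pJet_base hf, pJet_uVar i (k, l)]
  split_ifs <;> simp

theorem coeff_natCast (k l : ℕ) : coeff k l = pJet (k, l) := by simp [coeff]

theorem coeff_of_neg {k l : ℤ} (h : k < 0 ∨ l < 0) : coeff k l = 0 := if_neg (by omega)

theorem coeff_mul_uVar {f : DiffFun} (hf : f ∈ BaseFun) (k l : ℤ) (a b : ℕ) :
    coeff k l (f * uVar a b) = if k = a ∧ l = b then f else 0 := by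
  by_cases h : k < 0 ∨ l < 0
  · rw [coeff_of_neg h, if_neg (by omega), LinearMap.zero_apply]
  · lift k to ℕ using by omega
    lift l to ℕ using by omega
    rw [coeff_natCast, pJet_mul_uVar hf]
    simp

theorem coeff_base {w : DiffFun} (hw : w ∈ LinFun) (k l : ℤ) : coeff k l w ∈ BaseFun :=
  LinFun.induction (p := fun w => coeff k l w ∈ BaseFun)
    (fun f hf a b => by
      rw [coeff_mul_uVar hf]
      split_ifs
      exacts [hf, zero_mem _])
    (by rw [map_zero]; exact zero_mem _)
    (fun η θ h h' => by rw [map_add]; exact add_mem h h')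
    (fun r η h => by rw [map_smul]; exact BaseFun.smul_mem h r) hw

/-- A linear differential function is determined by its coefficients, as the Euler derivation
`∑ u_kl ∂_{u_kl}` fixes it. -/
theorem eq_sum_pJet {w : DiffFun} (hw : w ∈ LinFun) : w = ∑ᶠ i, uVar i.1 i.2 * pJet i w := by
  have h := LinFun.ext (A := vectorField 0 fun i => uVar i.1 i.2) (B := 1)
    (fun f hf k l => by
      rw [vectorField_mul_uVar hf, pBase_zero, zero_mul, zero_add, Module.End.one_apply]) hw
  rw [vectorField_apply, pBase_zero, zero_add] at h
  exact h.symm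

theorem coeff_pBase {w : DiffFun} (hw : w ∈ LinFun) (k l : ℤ) (b : Base) :
    coeff k l (pBase b w) = pBase b (coeff k l w) :=
  LinFun.ext (A := coeff k l * pBase b) (B := pBase b * coeff k l) (fun f hf k l => by
    simp only [Module.End.mul_apply, pBase_mul_uVar, coeff_mul_uVar hf,
      coeff_mul_uVar (pBase_mem hf b)]
    split_ifs <;> simp) hw

theorem coeff_dXi {w : DiffFun} (hw : w ∈ LinFun) (k l : ℕ) :
    coeff k l (dXi w) = ((k : ℝ) + 1) • coeff (k + 1 : ℕ) l w :=
  LinFun.ext (A := coeff k l * dXi) (B := ((k : ℝ) + 1) • coeff (k + 1 : ℕ) l) (fun f hf a b => by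
    rw [Module.End.mul_apply, dXi_mul_uVar hf, LinearMap.smul_apply, coeff_mul_uVar hf,
      coeff_mul_uVar (mul_mem hf (natCast_mem_baseFun a))]
    cases a with
    | zero =>
      rw [if_neg (c := ((k + 1 : ℕ) : ℤ) = (0 : ℕ) ∧ (l : ℤ) = b) (by omega)]
      simp
    | succ a =>
      by_cases h : k = a ∧ l = b
      · obtain ⟨rfl, rfl⟩ := h
        simp [Algebra.smul_def, mul_comm]
      · rw [if_neg (by omega), if_neg (by omega), smul_zero]) hw

/-- The coefficients of `F w`: equated to zero, these are the determining equations of linear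
generalized symmetries. -/
theorem coeff_F {w : DiffFun} (hw : w ∈ LinFun) (k l : ℤ) :
    coeff k l (F w) = pBase (1, 0, 0) (coeff k l w) + xVar * pBase (0, 0, 1) (coeff k l w) -
      pBase (0, 1, 0) (pBase (0, 1, 0) (coeff k l w)) -
      ((2 : ℝ) • pBase (0, 1, 0) (coeff (k - 1) l w) +
        ((k : ℝ) + 1) • coeff (k + 1) (l - 1) w) :=
  LinFun.ext (A := coeff k l * F)
    (B := pBase (1, 0, 0) * coeff k l + mulOp xVar * (pBase (0, 0, 1) * coeff k l) -
      pBase (0, 1, 0) * (pBase (0, 1, 0) * coeff k l) -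
      ((2 : ℝ) • (pBase (0, 1, 0) * coeff (k - 1) l) + ((k : ℝ) + 1) • coeff (k + 1) (l - 1)))
    (fun f hf a b => by
      have m1 := sub_mem (add_mem (pBase_mem hf (1, 0, 0))
        (mul_mem xVar_mem (pBase_mem hf (0, 0, 1)))) (pBase_mem (pBase_mem hf (0, 1, 0)) (0, 1, 0))
      have m2 := mul_mem two_mem_baseFun (pBase_mem hf (0, 1, 0))
      have m3 := mul_mem hf (natCast_mem_baseFun a)
      simp only [Module.End.mul_apply, LinearMap.add_apply, LinearMap.sub_apply,
        LinearMap.smul_apply, F_mul_uVar hf, map_sub, coeff_mul_uVar hf, coeff_mul_uVar m1,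
        coeff_mul_uVar m2, coeff_mul_uVar m3, mulOp, LinearMap.mulLeft_apply]
      have e1 : (k - 1 = a ∧ l = b) ↔ (k = (a + 1 : ℕ) ∧ l = b) := by omega
      -- for `a = 0` both sides vanish, the right one because its condition forces `k + 1 = 0`
      have e2 : (if k = (a - 1 : ℕ) ∧ l = (b + 1 : ℕ) then f * (a : DiffFun) else 0) =
          ((k : ℝ) + 1) • (if k + 1 = a ∧ l - 1 = b then f else 0) := by
        by_cases h : k + 1 = a ∧ l - 1 = b
        · obtain ⟨h1, h2⟩ := h
          rw [if_pos (c := k + 1 = a ∧ l - 1 = b) ⟨h1, h2⟩,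
            show (k : ℝ) + 1 = (a : ℝ) by exact_mod_cast h1, Algebra.smul_def, map_natCast,
            mul_comm]
          rcases Nat.eq_zero_or_pos a with rfl | ha
          · simp
          · rw [if_pos (by omega)]
        · rw [if_neg h, smul_zero]
          rcases Nat.eq_zero_or_pos a with rfl | ha
          · simp
          · rw [if_neg (by omega)]
      have e3 : (2 : DiffFun) * pBase (0, 1, 0) f = (2 : ℝ) • pBase (0, 1, 0) f := by
        rw [Algebra.smul_def, map_ofNat]
      rw [e2, e3]
      simp only [e1]
      generalize ((k : ℝ) + 1) • (if k + 1 = a ∧ l - 1 = b then f else 0) = z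
      split_ifs <;>
      · try simp only [map_zero, mul_zero, smul_zero]
        abel) hw

/-! ### Polynomiality of the coefficients -/

theorem pBase_pow_eq_zero {w : DiffFun} (hw : w ∈ LinFun) (b : Base) (m : ℕ)
    (h : ∀ k l : ℤ, (pBase b ^ m) (coeff k l w) = 0) :
    ((pBase b : Module.End ℝ DiffFun) ^ m) w = 0 := by
  have h1 : ((pBase b : Module.End ℝ DiffFun) ^ m) w ∈ LinFun ∧
      ∀ k l : ℤ, coeff k l ((pBase b ^ m) w) = (pBase b ^ m) (coeff k l w) := by
    clear h
    induction m with
    | zero => exact ⟨by simpa, fun k l => by simp⟩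
    | succ m ih =>
      simp only [pow_succ', Module.End.mul_apply]
      exact ⟨pBase_lin ih.1 b, fun k l => by rw [coeff_pBase ih.1, ih.2]⟩
  rw [eq_sum_pJet h1.1, finsum_congr (g := fun _ => 0) fun i => ?_, finsum_zero]
  rw [← coeff_natCast, h1.2, h, mul_zero]

theorem pBase_xVar_mul (b : Base) (w : DiffFun) :
    pBase b (xVar * w) = xVar * pBase b w + b.2.1 • w := by
  rw [pBase_mul, pBase_xVar, Algebra.smul_def, add_comm]

theorem exists_coeff_eq_zero (w : DiffFun) :
    ∃ n : ℕ, ∀ k l : ℤ, (n : ℤ) ≤ k + l → coeff k l w = 0 := by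
  refine ⟨(finite_pJet w).toFinset.sup (fun i => i.1 + i.2) + 1, fun k l h => ?_⟩
  by_cases h' : k < 0 ∨ l < 0
  · rw [coeff_of_neg h', LinearMap.zero_apply]
  lift k to ℕ using by omega
  lift l to ℕ using by omega
  rw [coeff_natCast]
  by_contra hne
  have := Finset.le_sup (f := fun i : ℕ × ℕ => i.1 + i.2)
    ((finite_pJet w).mem_toFinset.2 (show (k, l) ∈ {i | pJet i w ≠ 0} from hne))
  simp only at this
  omega

theorem determining_coeff {w : DiffFun} (hw : w ∈ LinSym) :
    Determining (pBase (1, 0, 0)) (pBase (0, 1, 0)) (pBase (0, 0, 1)) (mulOp xVar)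
      fun k l => coeff k l w := fun k l => by
  have h := coeff_F hw.1 k l
  rw [LinearMap.mem_ker.1 hw.2, map_zero] at h
  exact sub_eq_zero.1 h.symm

theorem exists_pow_dx {w : DiffFun} (hw : w ∈ LinSym) :
    ∃ m : ℕ, ((pBase (0, 1, 0) : Module.End ℝ DiffFun) ^ m) w = 0 := by
  obtain ⟨n, hn⟩ := exists_coeff_eq_zero w
  exact ⟨2 * n + 1, pBase_pow_eq_zero hw.1 _ _ fun k l =>
    (determining_coeff hw).exists_pow_X (pBase_comm _ _) (pBase_comm _ _)
      (fun v => by simpa [mulOp] using pBase_xVar_mul (0, 1, 0) v)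
      (fun k l h => by rw [coeff_of_neg h, LinearMap.zero_apply])
      (fun k l h => hn k l h.le) k l⟩

theorem exists_pow_dy {w : DiffFun} (hw : w ∈ LinSym) :
    ∃ m : ℕ, ((pBase (0, 0, 1) : Module.End ℝ DiffFun) ^ m) w = 0 := by
  obtain ⟨n, hn⟩ := exists_coeff_eq_zero w
  obtain ⟨m, hm⟩ := (determining_coeff hw).exists_pow_Y (pBase_comm _ _) (pBase_comm _ _)
    (pBase_comm _ _) (fun v => by simpa [mulOp] using pBase_xVar_mul (0, 1, 0) v)
    (fun v => by simpa [mulOp] using pBase_xVar_mul (0, 0, 1) v)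
    (fun k l h => by rw [coeff_of_neg h, LinearMap.zero_apply]) hn
  exact ⟨m, pBase_pow_eq_zero hw.1 _ _ hm⟩

theorem exists_pow_dXi {w : DiffFun} (hw : w ∈ LinFun) : ∃ m : ℕ, (dXi ^ m) w = 0 := by
  have hle : ∀ {m n : ℕ} {v : DiffFun}, m ≤ n → (dXi ^ m) v = 0 → (dXi ^ n) v = 0 := by
    intro m n v hmn h
    obtain ⟨d, rfl⟩ := Nat.exists_eq_add_of_le hmn
    rw [add_comm, pow_add, Module.End.mul_apply, h, map_zero]
  refine LinFun.induction (p := fun w => ∃ m : ℕ, (dXi ^ m) w = 0) (fun f hf k l => ?_)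
    ⟨0, by simp⟩ ?_ ?_ hw
  · refine ⟨k + 1, ?_⟩
    induction k generalizing f with
    | zero => simp [dXi_mul_uVar hf]
    | succ k ih =>
      rw [pow_succ, Module.End.mul_apply, dXi_mul_uVar hf]
      exact ih _ (mul_mem hf (natCast_mem_baseFun _))
  · rintro η θ ⟨m, h⟩ ⟨n, h'⟩
    exact ⟨max m n, by rw [map_add, hle (le_max_left m n) h, hle (le_max_right m n) h', add_zero]⟩
  · rintro r η ⟨m, h⟩
    exact ⟨m, by rw [map_smul, h, smul_zero]⟩

/-! ### Lowering operators on symmetries -/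

theorem pBase_two (b : Base) : pBase b 2 = 0 := pBase_natCast b 2

theorem pBase_three (b : Base) : pBase b 3 = 0 := pBase_natCast b 3

theorem dy_F {w : DiffFun} (hw : w ∈ LinFun) :
    F (pBase (0, 0, 1) w) = pBase (0, 0, 1) (F w) :=
  LinFun.ext (A := F * pBase (0, 0, 1)) (B := pBase (0, 0, 1) * F) (fun f hf k l => by
    simp only [Module.End.mul_apply, F_mul_uVar hf, F_mul_uVar (pBase_mem hf _),
      map_sub, map_add, pBase_mul, pBase_uVar, mul_zero, add_zero, pBase_two, pBase_natCast,
      pBase_xVar, pBase_comm (0, 0, 1) (1, 0, 0), pBase_comm (0, 0, 1) (0, 1, 0), map_zero]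
    ring) hw

theorem dx_F {w : DiffFun} (hw : w ∈ LinFun) :
    F (pBase (0, 1, 0) w) = pBase (0, 1, 0) (F w) - pBase (0, 0, 1) w :=
  LinFun.ext (A := F * pBase (0, 1, 0)) (B := pBase (0, 1, 0) * F - pBase (0, 0, 1))
    (fun f hf k l => by
      simp only [Module.End.mul_apply, LinearMap.sub_apply, F_mul_uVar hf,
        F_mul_uVar (pBase_mem hf _), map_sub, map_add, pBase_mul, pBase_uVar, mul_zero, add_zero,
        pBase_two, pBase_natCast, pBase_xVar, pBase_comm (0, 1, 0) (1, 0, 0),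
        pBase_comm (0, 1, 0) (0, 0, 1), map_one]
      ring) hw

theorem dXi_F {w : DiffFun} (hw : w ∈ LinFun) :
    F (dXi w) = dXi (F w) + 2 * pBase (0, 1, 0) w :=
  LinFun.ext (A := F * dXi) (B := dXi * F + mulOp 2 * pBase (0, 1, 0)) (fun f hf k l => by
    have m1 := sub_mem (add_mem (pBase_mem hf (1, 0, 0))
        (mul_mem xVar_mem (pBase_mem hf (0, 0, 1)))) (pBase_mem (pBase_mem hf (0, 1, 0)) (0, 1, 0))
    have m2 := mul_mem two_mem_baseFun (pBase_mem hf (0, 1, 0))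
    have m3 := mul_mem hf (natCast_mem_baseFun k)
    cases k with
    | zero =>
      simp only [Module.End.mul_apply, LinearMap.add_apply, F_mul_uVar hf,
        F_mul_uVar m3, map_sub, dXi_mul_uVar hf, dXi_mul_uVar m1, dXi_mul_uVar m2,
        dXi_mul_uVar m3, pBase_mul, pBase_uVar, pBase_natCast, mulOp, LinearMap.mulLeft_apply]
      simp
      ring
    | succ k =>
      simp only [Module.End.mul_apply, LinearMap.add_apply, F_mul_uVar hf,
        F_mul_uVar m3, map_sub, dXi_mul_uVar hf, dXi_mul_uVar m1, dXi_mul_uVar m2,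
        dXi_mul_uVar m3, pBase_mul, pBase_uVar, pBase_natCast, mulOp, LinearMap.mulLeft_apply,
        Nat.add_sub_cancel, mul_zero, add_zero]
      push_cast
      ring) hw

theorem dXi_base_mul {f : DiffFun} (hf : f ∈ BaseFun) (w : DiffFun) : dXi (f * w) = f * dXi w := by
  rw [dXi, vectorField_mul, vectorField_base hf, pBase_zero, zero_mul, zero_add]

theorem dXi_Dx {w : DiffFun} (hw : w ∈ LinFun) : dXi (Dx w) = Dx (dXi w) + w :=
  LinFun.ext (A := dXi * Dx) (B := Dx * dXi + 1) (fun f hf k l => by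
    have m3 := mul_mem hf (natCast_mem_baseFun k)
    simp only [Module.End.mul_apply, LinearMap.add_apply, Module.End.one_apply, Dx_mul_uVar hf,
      dXi_mul_uVar hf, dXi_mul_uVar (pBase_mem hf _), Dx_mul_uVar m3, map_add, pBase_mul,
      pBase_natCast]
    cases k with
    | zero => simp
    | succ k =>
      push_cast
      simp
      ring) hw

theorem dXi_Dy {w : DiffFun} (hw : w ∈ LinFun) : dXi (Dy w) = Dy (dXi w) :=
  LinFun.ext (A := dXi * Dy) (B := Dy * dXi) (fun f hf k l => by
    have m3 := mul_mem hf (natCast_mem_baseFun k)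
    simp only [Module.End.mul_apply, Dy_mul_uVar hf,
      dXi_mul_uVar hf, dXi_mul_uVar (pBase_mem hf _), Dy_mul_uVar m3, map_add, pBase_mul,
      pBase_natCast]
    ring) hw

theorem dXi_pBase (b : Base) {w : DiffFun} (hw : w ∈ LinFun) :
    pBase b (dXi w) = dXi (pBase b w) :=
  LinFun.ext (A := pBase b * dXi) (B := dXi * pBase b) (fun f hf k l => by
    simp only [Module.End.mul_apply, dXi_mul_uVar hf, dXi_mul_uVar (pBase_mem hf _), pBase_mul,
      pBase_uVar, pBase_natCast, mul_zero, add_zero]) hw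

theorem dy_P3 {w : DiffFun} (hw : w ∈ LinFun) :
    pBase (0, 0, 1) (P3 w) = P3 (pBase (0, 0, 1) w) + (-3 : ℝ) • w := by
  simp only [P3_apply, map_sub, map_add, pBase_mul, pow_succ, pow_zero, one_mul, pBase_three,
    pBase_tVar, pBase_xVar, pBase_yVar, pBase_Dx _ hw, pBase_Dy _ hw, map_zero, map_one,
    Algebra.smul_def, map_neg, map_ofNat]
  ring

theorem dy_P2 {w : DiffFun} (hw : w ∈ LinFun) :
    pBase (0, 0, 1) (P2 w) = P2 (pBase (0, 0, 1) w) := by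
  simp only [P2_apply, map_add, pBase_mul, pow_succ, pow_zero, one_mul, pBase_two,
    pBase_tVar, pBase_xVar, pBase_Dx _ hw, pBase_Dy _ hw, map_zero]
  ring

theorem dx_P2 {w : DiffFun} (hw : w ∈ LinFun) :
    pBase (0, 1, 0) (P2 w) = P2 (pBase (0, 1, 0) w) + (1 : ℝ) • w := by
  simp only [P2_apply, map_add, pBase_mul, pow_succ, pow_zero, one_mul, pBase_two,
    pBase_tVar, pBase_xVar, pBase_Dx _ hw, pBase_Dy _ hw, map_zero, map_one, one_smul]
  ring

theorem pBase_P1 {b : Base} (hb : b.1 = 0) {w : DiffFun} (hw : w ∈ LinFun) :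
    pBase b (P1 w) = P1 (pBase b w) := by
  simp only [P1_apply, map_add, pBase_mul, pBase_tVar, hb, pBase_Dx _ hw, pBase_Dy _ hw, map_zero]
  ring

theorem dXi_P1 {w : DiffFun} (hw : w ∈ LinFun) : dXi (P1 w) = P1 (dXi w) + (1 : ℝ) • w := by
  simp only [P1_apply, map_add, dXi_base_mul tVar_mem, dXi_Dx hw, dXi_Dy hw, one_smul]
  ring

/-! ### Symmetries are generated by the operators `P` -/

theorem P1_mem {w : DiffFun} (hw : w ∈ LinSym) : P1 w ∈ LinSym :=
  UpsilonR.mem_linSym P1_mem_upsilonR w hw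

theorem P2_mem {w : DiffFun} (hw : w ∈ LinSym) : P2 w ∈ LinSym :=
  UpsilonR.mem_linSym P2_mem_upsilonR w hw

theorem P3_mem {w : DiffFun} (hw : w ∈ LinSym) : P3 w ∈ LinSym :=
  UpsilonR.mem_linSym P3_mem_upsilonR w hw

theorem P0_pow_uVar (l : ℕ) : (P0 ^ l) (uVar 0 0) = uVar 0 l := by
  induction l with
  | zero => simp
  | succ l ih => rw [pow_succ', Module.End.mul_apply, ih, P0_apply, Dy_uVar]

/-- A symmetry annihilated by all three lowering operators is a combination of the `u_0l` with
constant coefficients. -/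
theorem mem_span_P0 {w : DiffFun} (hw : w ∈ LinSym) (hy : pBase (0, 0, 1) w = 0)
    (hx : pBase (0, 1, 0) w = 0) (hξ : dXi w = 0) :
    w ∈ Submodule.span ℝ {z | ∃ l : ℕ, z = (P0 ^ l) (uVar 0 0)} := by
  have hcy : ∀ k l : ℤ, pBase (0, 0, 1) (coeff k l w) = 0 := fun k l => by
    rw [← coeff_pBase hw.1, hy, map_zero]
  have hcx : ∀ k l : ℤ, pBase (0, 1, 0) (coeff k l w) = 0 := fun k l => by
    rw [← coeff_pBase hw.1, hx, map_zero]
  have hs : ∀ k l : ℕ, coeff (k + 1 : ℕ) l w = 0 := fun k l => by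
    have h := coeff_dXi hw.1 k l
    rw [hξ, map_zero, eq_comm, smul_eq_zero] at h
    exact h.resolve_left (by positivity)
  have hct : ∀ l : ℕ, pBase (1, 0, 0) (coeff (0 : ℕ) l w) = 0 := fun l => by
    have h := determining_coeff hw (0 : ℕ) l
    have h1 : coeff ((0 : ℕ) + 1) ((l : ℤ) - 1) w = 0 := by
      cases l with
      | zero => rw [coeff_of_neg (by simp), LinearMap.zero_apply]
      | succ l => simpa using hs 0 l
    simpa only [hcy, hcx, h1, map_zero, add_zero, sub_zero, smul_zero] using h
  have hconst : ∀ l : ℕ, ∃ r : ℝ, coeff (0 : ℕ) l w = algebraMap ℝ DiffFun r := fun l => by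
    refine exists_const (coeff_base hw.1 _ _) fun b => ?_
    rw [pBase_eq, hct, hcx, hcy, smul_zero, smul_zero, smul_zero, add_zero, add_zero]
  rw [eq_sum_pJet hw.1]
  refine finsum_induction (· ∈ Submodule.span ℝ {z | ∃ l : ℕ, z = (P0 ^ l) (uVar 0 0)})
    (Submodule.zero_mem _) (fun _ _ => Submodule.add_mem _) ?_
  rintro ⟨k, l⟩
  rw [← coeff_natCast]
  cases k with
  | zero =>
    obtain ⟨r, hr⟩ := hconst l
    rw [hr, mul_comm, ← Algebra.smul_def]
    exact Submodule.smul_mem _ _ (Submodule.subset_span ⟨l, (P0_pow_uVar l).symm⟩)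
  | succ k =>
    rw [hs, mul_zero]
    exact Submodule.zero_mem _

theorem linSym_le_lambdaR : LinSym ≤ LambdaR := by
  intro w₀ hw₀
  -- `h3`, `h2`, `h1` expand symmetries in fewer and fewer of the three kernels, by one more
  -- Taylor expansion each
  have h3 : ∀ (a b c : ℕ) (w : DiffFun), w ∈ LinSym → pBase (0, 0, 1) w = 0 →
      pBase (0, 1, 0) w = 0 → dXi w = 0 → (P3 ^ a) ((P2 ^ b) ((P1 ^ c) w)) ∈ LambdaR := by
    intro a b c w hw hy hx hξ
    refine (Submodule.span_le (p := LambdaR.comap (P3 ^ a * P2 ^ b * P1 ^ c))).2 ?_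
      (mem_span_P0 hw hy hx hξ)
    rintro _ ⟨l, rfl⟩
    exact Submodule.subset_span ⟨a, b, c, l, rfl⟩
  have h2 : ∀ (a b : ℕ) (w : DiffFun), w ∈ LinSym → pBase (0, 0, 1) w = 0 →
      pBase (0, 1, 0) w = 0 → (P3 ^ a) ((P2 ^ b) w) ∈ LambdaR := by
    intro a b w hw hy hx
    obtain ⟨m, hm⟩ := exists_pow_dXi hw.1
    refine (Submodule.span_le (p := LambdaR.comap (P3 ^ a * P2 ^ b))).2 ?_
      (mem_span_pow_of_commutator (A := dXi) (B := P1)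
        (W := LinSym ⊓ LinearMap.ker (pBase (0, 0, 1)) ⊓ LinearMap.ker (pBase (0, 1, 0)))
        one_ne_zero ?_ ?_ (fun w hw => dXi_P1 hw.1.1.1) m ⟨⟨hw, hy⟩, hx⟩ hm)
    · rintro _ ⟨c, w, ⟨⟨hw, hy⟩, hx⟩, hξ, rfl⟩
      exact h3 a b c w hw hy hx hξ
    · rintro w ⟨⟨hw, hy⟩, hx⟩
      have hy : pBase (0, 0, 1) w = 0 := hy
      have hx : pBase (0, 1, 0) w = 0 := hx
      have hF : F w = 0 := hw.2
      refine ⟨⟨⟨dXi_lin hw.1, LinearMap.mem_ker.2 ?_⟩, LinearMap.mem_ker.2 ?_⟩,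
        LinearMap.mem_ker.2 ?_⟩
      · rw [dXi_F hw.1, hF, hx, map_zero, mul_zero, add_zero]
      · rw [dXi_pBase _ hw.1, hy, map_zero]
      · rw [dXi_pBase _ hw.1, hx, map_zero]
    · rintro w ⟨⟨hw, hy⟩, hx⟩
      have hy : pBase (0, 0, 1) w = 0 := hy
      have hx : pBase (0, 1, 0) w = 0 := hx
      refine ⟨⟨P1_mem hw, LinearMap.mem_ker.2 ?_⟩, LinearMap.mem_ker.2 ?_⟩
      · rw [pBase_P1 rfl hw.1, hy, map_zero]
      · rw [pBase_P1 rfl hw.1, hx, map_zero]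
  have h1 : ∀ (a : ℕ) (w : DiffFun), w ∈ LinSym → pBase (0, 0, 1) w = 0 →
      (P3 ^ a) w ∈ LambdaR := by
    intro a w hw hy
    obtain ⟨m, hm⟩ := exists_pow_dx hw
    refine (Submodule.span_le (p := LambdaR.comap (P3 ^ a))).2 ?_
      (mem_span_pow_of_commutator (A := pBase (0, 1, 0)) (B := P2)
        (W := LinSym ⊓ LinearMap.ker (pBase (0, 0, 1)))
        one_ne_zero ?_ ?_ (fun w hw => dx_P2 hw.1.1) m ⟨hw, hy⟩ hm)
    · rintro _ ⟨b, w, ⟨hw, hy⟩, hx, rfl⟩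
      exact h2 a b w hw hy hx
    · rintro w ⟨hw, hy⟩
      have hy : pBase (0, 0, 1) w = 0 := hy
      have hF : F w = 0 := hw.2
      refine ⟨⟨pBase_lin hw.1 _, LinearMap.mem_ker.2 ?_⟩, LinearMap.mem_ker.2 ?_⟩
      · rw [dx_F hw.1, hF, hy, map_zero, sub_zero]
      · rw [pBase_comm, hy, map_zero]
    · rintro w ⟨hw, hy⟩
      have hy : pBase (0, 0, 1) w = 0 := hy
      exact ⟨P2_mem hw, LinearMap.mem_ker.2 (by rw [dy_P2 hw.1, hy, map_zero])⟩
  obtain ⟨m, hm⟩ := exists_pow_dy hw₀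
  refine (Submodule.span_le (p := LambdaR)).2 ?_
    (mem_span_pow_of_commutator (A := pBase (0, 0, 1)) (B := P3) (W := LinSym) (c := -3)
      (by norm_num) ?_ (fun w hw => P3_mem hw) (fun w hw => dy_P3 hw.1) m hw₀ hm)
  · rintro _ ⟨a, w, hw, hy, rfl⟩
    exact h1 a w hw hy
  · intro w hw
    have hF : F w = 0 := hw.2
    exact ⟨pBase_lin hw.1 _, LinearMap.mem_ker.2 (by rw [dy_F hw.1, hF, map_zero])⟩

theorem linSym_eq_lambdaR : LinSym = LambdaR := le_antisymm linSym_le_lambdaR lambdaR_le_linSym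

end Kolmogorov

theorem mainTheorem2 :
    Kolmogorov.LinGenSym = (Kolmogorov.LambdaR : Set Kolmogorov.DiffFun) ∧
    (∀ η : Kolmogorov.DiffFun, η ∈ Kolmogorov.LambdaR ↔
      ∃ Q ∈ Kolmogorov.UpsilonR, Q (Kolmogorov.uVar 0 0) = η) ∧
    (∀ η ∈ Kolmogorov.LinGenSym, ∀ θ ∈ Kolmogorov.LinGenSym,
      Kolmogorov.bracket η θ ∈ Kolmogorov.LinGenSym) := by
  open Kolmogorov in
  rw [linGenSym_eq]
  refine ⟨by rw [linSym_eq_lambdaR], fun η => ⟨exists_upsilonR_of_mem_lambdaR, ?_⟩, ?_⟩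
  · rintro ⟨Q, hQ, rfl⟩
    exact linSym_le_lambdaR (UpsilonR.mem_linSym hQ _ uVar_mem_linSym)
  · intro η hη θ hθ
    obtain ⟨Q, hQ, rfl⟩ := exists_upsilonR_of_mem_lambdaR (linSym_le_lambdaR hη)
    obtain ⟨R, hR, rfl⟩ := exists_upsilonR_of_mem_lambdaR (linSym_le_lambdaR hθ)
    have hQu : Q (uVar 0 0) ∈ LinSym := hη
    have hRu : R (uVar 0 0) ∈ LinSym := hθ
    rw [bracket_eq hQ hR hQu.1 hRu.1]
    exact sub_mem (UpsilonR.mem_linSym hR _ hQu) (UpsilonR.mem_linSym hQ _ hRu)
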